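/- Let $\mathcal X,\mathcal Y,\hat{\mathcal X}$ be finite sets, $P_{X,Y}$ a probability distribution on $\mathcal X\times\mathcal Y$, $D_{\min}\le D_{\max}$ reals, and $d:\mathcal X\times\hat{\mathcal X}\to[D_{\min},D_{\max}]$ a distortion measure such that for every $x$ with $P_X(x)>0$ there is $\hat x$ with $d(x,\hat x)=D_{\min}$. For $n\ge 1$ let $(X^n,Y^n)$ be $n$ i.i.d. copies of $(X,Y)\sim P_{X,Y}$ and put $d(x^n,\hat x^n)=\frac1n\sum_{i=1}^n d(x_i,\hat x_i)$. Let $f:[D_{\min},D_{\max}]\to[0,\infty)$ be non-decreasing and left-continuous. Mutual information is taken with respect to any fixed logarithm base larger than $1$. For $t>f(D_{\min})$ define $$L^{(G)}(n,t,f)=\min_{P_{\hat X^n|X^n,Y^n}:\ \mathbb E[f(d(X^n,\hat X^n))]\le t}\ \frac1n I(Y^n;\hat X^n),\qquad L(D)=\min_{P_{\hat X|X,Y}:\ \mathbb E[d(X,\hat X)]\le D} I(Y;\hat X)\quad (D\in[D_{\min},D_{\max}]),$$ where the first minimum is over all $n$-letter mechanisms, and let $L^{(M)}(n,t,f)$ be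 the same minimum as $L^{(G)}(n,t,f)$ restricted to stationary memoryless mechanisms $P_{\hat X^n|X^n,Y^n}=(P_{\hat X|X,Y})^n$. Let $$f_l^{-1}(t)=\sup\{D\in[D_{\min},D_{\max}]:f(D)<t\},\qquad f_u^{-1}(t)=\sup\{D\in[D_{\min},D_{\max}]:f(D)\le t\}.$$ For a function $r$ on the interval $(f(D_{\min}),\infty)$ let $r^{**}(t)$ be the supremum of $s(t)$ over all convex functions $s$ on that interval with $s\le r$ (the lower convex envelope). Then, for every $t>f(D_{\min})$, all these minima are attained, the limit $L^{(G)}(t,f)=\lim_{n\to\infty}L^{(G)}(n,t,f)$ exists, and $$L^{(G)}(t,f)=(L\circ f_l^{-1})^{**}(t)=(L\circ f_u^{-1})^{**}(t).$$ In particular, if $f$ is convex, then $f_l^{-1}(t)=f_u^{-1}(t)=:f^{-1}(t)$, the limit $L^{(M)}(t,f)=\lim_{n\to\infty}L^{(M)}(n,t,f)$ exists, and $$L^{(G)}(t,f)=L^{(M)}(t,f)=L(f^{-1}(t)),$$ that is, stationary memoryless mechanisms are asymptotically optimal. -/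

import Mathlib

open Filter Topology Set

noncomputable section

namespace PrivacyLeakage

/-- Mutual information, with logarithms to base `b`, of a pair of finite-valued random variables
with joint probability mass function `q`. Terms with `q y z = 0` contribute `0`. -/
def mutualInfo {B C : Type*} [Fintype B] [Fintype C] (b : ℝ) (q : B → C → ℝ) : ℝ :=
  ∑ y, ∑ z, q y z * Real.logb b (q y z / ((∑ z', q y z') * (∑ y', q y' z)))

/-- `W x y z` is a conditional probability mass function of the released value `z` given the public
value `x` and the private value `y`. -/
def IsMechanism {A B C : Type*} [Fintype C] (W : A → B → C → ℝ) : Prop :=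
  ∀ x y, W x y ∈ stdSimplex ℝ C

/-- Mutual information between the private and the released value, when the (public, private) pair
has law `P` and the released value is produced by `W`. -/
def leakage {A B C : Type*} [Fintype A] [Fintype B] [Fintype C] (b : ℝ)
    (P : A × B → ℝ) (W : A → B → C → ℝ) : ℝ :=
  mutualInfo b (fun y z => ∑ x, P (x, y) * W x y z)

/-- Expectation of `c` applied to the public and the released value. -/
def expectedCost {A B C : Type*} [Fintype A] [Fintype B] [Fintype C]
    (P : A × B → ℝ) (W : A → B → C → ℝ) (c : A → C → ℝ) : ℝ :=
  ∑ x, ∑ y, ∑ z, P (x, y) * W x y z * c x z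

/-- Law of `n` independent copies of the (public, private) pair. -/
def iidSource {X Y : Type*} (P : X × Y → ℝ) (n : ℕ) : (Fin n → X) × (Fin n → Y) → ℝ :=
  fun p => ∏ i, P (p.1 i, p.2 i)

/-- The stationary memoryless `n`-letter mechanism built from a single-letter mechanism. -/
def memoryless {X Y Z : Type*} (W : X → Y → Z → ℝ) (n : ℕ) :
    (Fin n → X) → (Fin n → Y) → (Fin n → Z) → ℝ :=
  fun x y z => ∏ i, W (x i) (y i) (z i)

/-- The average per-letter distortion of two sequences of length `n`. -/
def blockDistortion {X Z : Type*} (d : X → Z → ℝ) (n : ℕ) (x : Fin n → X) (z : Fin n → Z) : ℝ :=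
  (∑ i, d (x i) (z i)) / n

section Leakages

variable {X Y Z : Type*} [Fintype X] [Fintype Y] [Fintype Z]

/-- Leakages of the single-letter mechanisms with expected distortion at most `D`. -/
def singleLetterLeakages (b : ℝ) (P : X × Y → ℝ) (d : X → Z → ℝ) (D : ℝ) : Set ℝ :=
  {r | ∃ W : X → Y → Z → ℝ, IsMechanism W ∧ expectedCost P W d ≤ D ∧ r = leakage b P W}

/-- The single-letter leakage `L(D)`. -/
def singleLetterLeakage (b : ℝ) (P : X × Y → ℝ) (d : X → Z → ℝ) (D : ℝ) : ℝ :=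
  sInf (singleLetterLeakages b P d D)

/-- Normalized leakages of all `n`-letter mechanisms with expected distortion cost at most `t`. -/
def generalLeakages (b : ℝ) (P : X × Y → ℝ) (d : X → Z → ℝ) (f : ℝ → ℝ) (t : ℝ) (n : ℕ) :
    Set ℝ :=
  {r | ∃ W : (Fin n → X) → (Fin n → Y) → (Fin n → Z) → ℝ, IsMechanism W ∧
    expectedCost (iidSource P n) W (fun x z => f (blockDistortion d n x z)) ≤ t ∧
    r = (1 / (n : ℝ)) * leakage b (iidSource P n) W}

/-- The minimal leakage `L^{(G)}(n, t, f)` of general `n`-letter mechanisms. -/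
def generalLeakage (b : ℝ) (P : X × Y → ℝ) (d : X → Z → ℝ) (f : ℝ → ℝ) (t : ℝ) (n : ℕ) : ℝ :=
  sInf (generalLeakages b P d f t n)

/-- Normalized leakages of the stationary memoryless `n`-letter mechanisms with expected distortion
cost at most `t`. -/
def memorylessLeakages (b : ℝ) (P : X × Y → ℝ) (d : X → Z → ℝ) (f : ℝ → ℝ) (t : ℝ) (n : ℕ) :
    Set ℝ :=
  {r | ∃ W : X → Y → Z → ℝ, IsMechanism W ∧
    expectedCost (iidSource P n) (memoryless W n) (fun x z => f (blockDistortion d n x z)) ≤ t ∧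
    r = (1 / (n : ℝ)) * leakage b (iidSource P n) (memoryless W n)}

/-- The minimal leakage `L^{(M)}(n, t, f)` of stationary memoryless `n`-letter mechanisms. -/
def memorylessLeakage (b : ℝ) (P : X × Y → ℝ) (d : X → Z → ℝ) (f : ℝ → ℝ) (t : ℝ) (n : ℕ) : ℝ :=
  sInf (memorylessLeakages b P d f t n)

end Leakages

/-- The lower inverse `f_l⁻¹(t) = sup {D ∈ [Dmin, Dmax] : f D < t}`. -/
def lowerInv (Dmin Dmax : ℝ) (f : ℝ → ℝ) (t : ℝ) : ℝ :=
  sSup {D | D ∈ Icc Dmin Dmax ∧ f D < t}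

/-- The upper inverse `f_u⁻¹(t) = sup {D ∈ [Dmin, Dmax] : f D ≤ t}`. -/
def upperInv (Dmin Dmax : ℝ) (f : ℝ → ℝ) (t : ℝ) : ℝ :=
  sSup {D | D ∈ Icc Dmin Dmax ∧ f D ≤ t}

/-- The lower convex envelope at `t` of the function `r` with domain `S`. -/
def lowerConvexEnvelope (S : Set ℝ) (r : ℝ → ℝ) (t : ℝ) : ℝ :=
  sSup {v | ∃ s : ℝ → ℝ, ConvexOn ℝ S s ∧ (∀ x ∈ S, s x ≤ r x) ∧ v = s t}

end PrivacyLeakage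

end

open PrivacyLeakage

/-! Write `r` for `L ∘ f_l⁻¹`. The limit is compared with the convex minorants of `r` from both
sides.

Upper bound. A memoryless mechanism whose expected distortion is strictly below `f_l⁻¹(t)` has
concentrated block distortion, so by Chebyshev its block cost is eventually at most `t`, while its
leakage per letter is the single-letter one. Convexity of `L` makes the price of the slack
arbitrarily small (`eventually_memorylessLeakage_le`). Mixing `n`-letter mechanisms makes
`generalLeakage` convex in `t`, so its limsup over `n` is itself a convex minorant of `r`, hence at
most the envelope.

Converse (`eventually_le_generalLeakage`). Split the blocks into `K` levels according to their cost.
On level `k`, of mass `p k` and upper end `T k`, the average letter law has mean distortion at most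
`f_l⁻¹(T k)`, and a variance bound puts its source marginal within `1/√n` of `p k * P`
(`abs_sum_frequency_le`). The conditional entropy of the block is at most `n` times the sum of those
of the letter laws, plus `log K` for the level (`condEntropy_sum_le`), and the latter vanishes after
division by `n`. Compactness absorbs the small source deviation (`exists_deviation_bound`).
Asymptotically the leakage is thus at least `∑ p k * r (T k)` with `∑ p k * T k ≤ t + η`. For a
convex `s ≤ r`, Jensen and the monotonicity of `s` bound this below by `s (t + η)`, and `s` is
continuous.

The two inverses give the same convex minorants. For convex `f` the function `r` is convex, so it is
its own envelope and memoryless mechanisms suffice. -/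

namespace PrivacyLeakage

/-! ### Conditional entropy and mutual information of finite measures. -/

/-- Conditional entropy `H(Y|Z)`, in nats, of a finite nonnegative measure `q` on pairs `(y, z)`. -/
noncomputable def condEntropy {B C : Type*} [Fintype B] [Fintype C] (q : B → C → ℝ) : ℝ :=
  (∑ y, ∑ z, Real.negMulLog (q y z)) - ∑ z, Real.negMulLog (∑ y, q y z)

/-- Pointwise Gibbs inequality, from `1 - 1/x ≤ log x` at `x = a / c`. -/
lemma sub_le_mul_log_sub_mul_log {a c : ℝ} (ha : 0 ≤ a) (hc : 0 ≤ c) (h : c = 0 → a = 0) :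
    a - c ≤ a * Real.log a - a * Real.log c := by
  rcases ha.eq_or_lt with rfl | ha'
  · simpa using hc
  have hc' : 0 < c := lt_of_le_of_ne hc fun h0 => ha'.ne' (h h0.symm)
  have := Real.one_sub_inv_le_log_of_pos (div_pos ha' hc')
  rw [Real.log_div ha'.ne' hc'.ne'] at this
  have h2 := mul_le_mul_of_nonneg_left this ha
  have : a * (1 - (a / c)⁻¹) = a - c := by field_simp
  linarith

section

variable {B C : Type*} [Fintype B] [Fintype C]

lemma continuous_condEntropy : Continuous (condEntropy : (B → C → ℝ) → ℝ) := by
  unfold condEntropy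
  refine Continuous.sub ?_ ?_
  · refine continuous_finsetSum _ fun y _ => continuous_finsetSum _ fun z _ => ?_
    exact Real.continuous_negMulLog.comp (by fun_prop)
  · refine continuous_finsetSum _ fun z _ => ?_
    exact Real.continuous_negMulLog.comp (by fun_prop)

lemma condEntropy_smul (c : ℝ) (q : B → C → ℝ) :
    condEntropy (fun y z => c * q y z) = c * condEntropy q := by
  unfold condEntropy
  simp only [← Finset.mul_sum, Real.negMulLog_mul, Finset.sum_add_distrib, ← Finset.sum_mul]
  rw [Finset.sum_comm (f := fun y z => q y z)]
  ring

/-- Variational upper bound on the conditional entropy by a sub-stochastic kernel `κ`. -/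
lemma condEntropy_le (q κ : B → C → ℝ) (hq : ∀ y z, 0 ≤ q y z) (hκ : ∀ y z, 0 ≤ κ y z)
    (hκ1 : ∀ z, ∑ y, κ y z ≤ 1) (h0 : ∀ y z, κ y z = 0 → q y z = 0) :
    condEntropy q ≤ -∑ y, ∑ z, q y z * Real.log (κ y z) := by
  have hQ : ∀ z, 0 ≤ ∑ y, q y z := fun z => Finset.sum_nonneg fun y _ => hq y z
  have key : ∀ y z, q y z - (∑ y', q y' z) * κ y z ≤
      q y z * Real.log (q y z) - q y z * Real.log (∑ y', q y' z) - q y z * Real.log (κ y z) := by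
    intro y z
    have hle : q y z ≤ ∑ y', q y' z :=
      Finset.single_le_sum (f := fun y' => q y' z) (fun y' _ => hq y' z) (Finset.mem_univ y)
    have hac : (∑ y', q y' z) * κ y z = 0 → q y z = 0 := by
      intro h
      rcases mul_eq_zero.1 h with h | h
      · exact le_antisymm (hle.trans h.le) (hq y z)
      · exact h0 y z h
    refine (sub_le_mul_log_sub_mul_log (hq y z) (mul_nonneg (hQ z) (hκ y z)) hac).trans ?_
    by_cases hz : q y z = 0
    · simp [hz]
    have h1 : (∑ y', q y' z) ≠ 0 := fun h => hz (hac (by rw [h, zero_mul]))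
    have h2 : κ y z ≠ 0 := fun h => hz (h0 y z h)
    rw [Real.log_mul h1 h2]
    linarith
  have hsum : 0 ≤ ∑ z, ∑ y, (q y z - (∑ y', q y' z) * κ y z) := by
    refine Finset.sum_nonneg fun z _ => ?_
    rw [Finset.sum_sub_distrib, ← Finset.mul_sum]
    nlinarith [hQ z, hκ1 z]
  have h3 := hsum.trans (Finset.sum_le_sum fun z _ => Finset.sum_le_sum fun y _ => key y z)
  simp only [Finset.sum_sub_distrib, ← Finset.sum_mul] at h3
  unfold condEntropy
  simp only [Real.negMulLog, neg_mul, Finset.sum_neg_distrib]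
  rw [Finset.sum_comm (f := fun y z => q y z * Real.log (q y z)),
    Finset.sum_comm (f := fun y z => q y z * Real.log (κ y z))]
  linarith

/-- The conditional law of `y` given `z`. -/
noncomputable def condKernel (q : B → C → ℝ) (y : B) (z : C) : ℝ := q y z / ∑ y', q y' z

omit [Fintype C] in
lemma condKernel_nonneg {q : B → C → ℝ} (hq : ∀ y z, 0 ≤ q y z) (y : B) (z : C) :
    0 ≤ condKernel q y z := div_nonneg (hq y z) (Finset.sum_nonneg fun y' _ => hq y' z)

-- Only `≤`: where `z` has zero mass the kernel vanishes, as `x / 0 = 0`. Hence the sub-stochastic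
-- kernels in `condEntropy_le`.
omit [Fintype C] in
lemma sum_condKernel_le (q : B → C → ℝ) (z : C) : ∑ y, condKernel q y z ≤ 1 := by
  unfold condKernel
  rw [← Finset.sum_div]
  exact div_self_le_one _

omit [Fintype C] in
lemma eq_zero_of_condKernel_eq_zero {q : B → C → ℝ} (hq : ∀ y z, 0 ≤ q y z) {y : B} {z : C}
    (h : condKernel q y z = 0) : q y z = 0 := by
  rcases div_eq_zero_iff.1 h with h | h
  · exact h
  · exact (Finset.sum_eq_zero_iff_of_nonneg fun y' _ => hq y' z).1 h y (Finset.mem_univ y)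

lemma condEntropy_eq {q : B → C → ℝ} (hq : ∀ y z, 0 ≤ q y z) :
    condEntropy q = -∑ y, ∑ z, q y z * Real.log (condKernel q y z) := by
  unfold condEntropy
  have : ∀ y z, q y z * Real.log (condKernel q y z) =
      q y z * Real.log (q y z) - q y z * Real.log (∑ y', q y' z) := by
    intro y z
    by_cases hz : q y z = 0
    · simp [hz]
    have h1 : (∑ y', q y' z) ≠ 0 := fun h =>
      hz ((Finset.sum_eq_zero_iff_of_nonneg fun y' _ => hq y' z).1 h y (Finset.mem_univ y))
    rw [condKernel, Real.log_div hz h1]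
    ring
  simp only [this, Finset.sum_sub_distrib, Real.negMulLog, neg_mul, Finset.sum_neg_distrib]
  rw [Finset.sum_comm (f := fun y z => q y z * Real.log (∑ y', q y' z))]
  simp only [← Finset.sum_mul]
  ring

/-- The conditional kernel of the sum is a competitor in `condEntropy_le` for each summand. With
`condEntropy_smul` this is concavity. -/
lemma condEntropy_add_le {q₁ q₂ : B → C → ℝ} (h₁ : ∀ y z, 0 ≤ q₁ y z) (h₂ : ∀ y z, 0 ≤ q₂ y z) :
    condEntropy q₁ + condEntropy q₂ ≤ condEntropy (fun y z => q₁ y z + q₂ y z) := by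
  have hq : ∀ y z, 0 ≤ q₁ y z + q₂ y z := fun y z => add_nonneg (h₁ y z) (h₂ y z)
  have e₁ := condEntropy_le q₁ (condKernel fun y z => q₁ y z + q₂ y z) h₁ (condKernel_nonneg hq)
    (sum_condKernel_le _) fun y z h => by
      have := eq_zero_of_condKernel_eq_zero hq h
      linarith [h₁ y z, h₂ y z]
  have e₂ := condEntropy_le q₂ (condKernel fun y z => q₁ y z + q₂ y z) h₂ (condKernel_nonneg hq)
    (sum_condKernel_le _) fun y z h => by
      have := eq_zero_of_condKernel_eq_zero hq h
      linarith [h₁ y z, h₂ y z]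
  rw [condEntropy_eq hq]
  simp only [add_mul, Finset.sum_add_distrib]
  linarith

lemma mutualInfo_eq (b : ℝ) {q : B → C → ℝ} (hq : ∀ y z, 0 ≤ q y z) :
    mutualInfo b q = ((∑ y, Real.negMulLog (∑ z, q y z)) - condEntropy q) / Real.log b := by
  have key : ∀ y z, q y z * Real.logb b (q y z / ((∑ z', q y z') * (∑ y', q y' z))) =
      (q y z * Real.log (q y z) - q y z * Real.log (∑ z', q y z') -
        q y z * Real.log (∑ y', q y' z)) / Real.log b := by
    intro y z
    by_cases hz : q y z = 0
    · simp [hz]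
    have h1 : (∑ y', q y' z) ≠ 0 := fun h =>
      hz ((Finset.sum_eq_zero_iff_of_nonneg fun y' _ => hq y' z).1 h y (Finset.mem_univ y))
    have h2 : (∑ z', q y z') ≠ 0 := fun h =>
      hz ((Finset.sum_eq_zero_iff_of_nonneg fun z' _ => hq y z').1 h z (Finset.mem_univ z))
    rw [Real.logb, Real.log_div hz (mul_ne_zero h2 h1), Real.log_mul h2 h1]
    ring
  unfold mutualInfo condEntropy
  simp only [key, ← Finset.sum_div]
  congr 1
  simp only [Finset.sum_sub_distrib, Real.negMulLog, neg_mul, Finset.sum_neg_distrib]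
  rw [Finset.sum_comm (f := fun y z => q y z * Real.log (∑ y', q y' z))]
  simp only [← Finset.sum_mul]
  ring

lemma mutualInfo_nonneg {b : ℝ} (hb : 1 < b) {q : B → C → ℝ} (hq : ∀ y z, 0 ≤ q y z)
    (h1 : ∑ y, ∑ z, q y z ≤ 1) : 0 ≤ mutualInfo b q := by
  rw [mutualInfo_eq b hq]
  refine div_nonneg (sub_nonneg.2 ?_) (Real.log_pos hb).le
  -- The competitor kernel ignores `z` and is the marginal of `y`.
  refine (condEntropy_le q (fun y _ => ∑ z, q y z) hq
    (fun y _ => Finset.sum_nonneg fun z _ => hq y z) (fun _ => h1) fun y z h =>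
      (Finset.sum_eq_zero_iff_of_nonneg fun z' _ => hq y z').1 h z (Finset.mem_univ z)).trans_eq ?_
  simp only [← Finset.sum_mul, Real.negMulLog, neg_mul, Finset.sum_neg_distrib]

end

/-! ### One-shot mechanisms: compactness and convexity. -/

section

variable {A B C : Type*} [Fintype A] [Fintype B] [Fintype C]

/-- Joint law of the private and the released value. -/
def outLaw (P : A × B → ℝ) (W : A → B → C → ℝ) (y : B) (z : C) : ℝ := ∑ x, P (x, y) * W x y z

/-- Entropy, in nats, of the private value. -/
noncomputable def privEntropy (P : A × B → ℝ) : ℝ := ∑ y, Real.negMulLog (∑ x, P (x, y))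

omit [Fintype A] [Fintype B] in
lemma IsMechanism.nonneg {W : A → B → C → ℝ} (hW : IsMechanism W) (x : A) (y : B) (z : C) :
    0 ≤ W x y z := (hW x y).1 z

omit [Fintype A] [Fintype B] in
lemma IsMechanism.sum_eq_one {W : A → B → C → ℝ} (hW : IsMechanism W) (x : A) (y : B) :
    ∑ z, W x y z = 1 := (hW x y).2

omit [Fintype B] in
lemma outLaw_nonneg {P : A × B → ℝ} (hP : ∀ p, 0 ≤ P p) {W : A → B → C → ℝ}
    (hW : IsMechanism W) (y : B) (z : C) : 0 ≤ outLaw P W y z :=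
  Finset.sum_nonneg fun x _ => mul_nonneg (hP _) (hW.nonneg x y z)

omit [Fintype B] in
lemma sum_outLaw (P : A × B → ℝ) {W : A → B → C → ℝ} (hW : IsMechanism W) (y : B) :
    ∑ z, outLaw P W y z = ∑ x, P (x, y) := by
  unfold outLaw
  rw [Finset.sum_comm]
  exact Finset.sum_congr rfl fun x _ => by rw [← Finset.mul_sum, hW.sum_eq_one, mul_one]

/-- The marginal of `y` is fixed by the source, so the mechanism enters only through `condEntropy`.
-/
lemma leakage_eq (b : ℝ) {P : A × B → ℝ} (hP : ∀ p, 0 ≤ P p) {W : A → B → C → ℝ}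
    (hW : IsMechanism W) :
    leakage b P W = (privEntropy P - condEntropy (outLaw P W)) / Real.log b := by
  have := mutualInfo_eq b (outLaw_nonneg hP hW)
  simp only [sum_outLaw P hW] at this
  exact this

lemma leakage_nonneg {b : ℝ} (hb : 1 < b) {P : A × B → ℝ} (hP : P ∈ stdSimplex ℝ (A × B))
    {W : A → B → C → ℝ} (hW : IsMechanism W) : 0 ≤ leakage b P W := by
  refine mutualInfo_nonneg hb (outLaw_nonneg hP.1 hW) ?_
  change ∑ y, ∑ z, outLaw P W y z ≤ 1
  rw [Finset.sum_congr rfl fun y _ => sum_outLaw P hW y, Finset.sum_comm,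
    ← Fintype.sum_prod_type' (f := fun x y => P (x, y))]
  exact hP.2.le

lemma continuous_expectedCost (P : A × B → ℝ) (c : A → C → ℝ) :
    Continuous fun W : A → B → C → ℝ => expectedCost P W c := by
  unfold expectedCost
  fun_prop

omit [Fintype A] [Fintype B] in
lemma isCompact_isMechanism : IsCompact {W : A → B → C → ℝ | IsMechanism W} := by
  have : {W : A → B → C → ℝ | IsMechanism W} =
      Set.pi univ fun _ => Set.pi univ fun _ => stdSimplex ℝ C := by
    ext W
    simp [IsMechanism, Set.mem_pi]
  rw [this]
  exact isCompact_univ_pi fun _ => isCompact_univ_pi fun _ => isCompact_stdSimplex ℝ C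

/-- The entropy form contains no quotient, so vanishing probabilities are harmless: `negMulLog` is
continuous at `0`. -/
lemma continuousOn_leakage (b : ℝ) {P : A × B → ℝ} (hP : ∀ p, 0 ≤ P p) :
    ContinuousOn (fun W : A → B → C → ℝ => leakage b P W) {W | IsMechanism W} := by
  have hc : Continuous fun W : A → B → C → ℝ => outLaw P W := by
    unfold outLaw
    fun_prop
  refine ContinuousOn.congr (f := fun W =>
    (privEntropy P - condEntropy (outLaw P W)) / Real.log b) ?_ fun W hW => leakage_eq b hP hW
  exact ((continuous_const.sub (continuous_condEntropy.comp hc)).div_const _).continuousOn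

lemma expectedCost_combo (P : A × B → ℝ) (c : A → C → ℝ) (W₁ W₂ : A → B → C → ℝ) (u v : ℝ) :
    expectedCost P (fun x y z => u * W₁ x y z + v * W₂ x y z) c =
      u * expectedCost P W₁ c + v * expectedCost P W₂ c := by
  simp only [expectedCost, Finset.mul_sum, ← Finset.sum_add_distrib]
  exact Finset.sum_congr rfl fun x _ => Finset.sum_congr rfl fun y _ =>
    Finset.sum_congr rfl fun z _ => by ring

omit [Fintype A] [Fintype B] in
lemma IsMechanism.combo {W₁ W₂ : A → B → C → ℝ} (h₁ : IsMechanism W₁) (h₂ : IsMechanism W₂)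
    {u v : ℝ} (hu : 0 ≤ u) (hv : 0 ≤ v) (huv : u + v = 1) :
    IsMechanism (fun x y z => u * W₁ x y z + v * W₂ x y z) :=
  fun x y => convex_stdSimplex ℝ C (h₁ x y) (h₂ x y) hu hv huv

lemma leakage_combo_le {b : ℝ} (hb : 1 < b) {P : A × B → ℝ} (hP : ∀ p, 0 ≤ P p)
    {W₁ W₂ : A → B → C → ℝ} (h₁ : IsMechanism W₁) (h₂ : IsMechanism W₂)
    {u v : ℝ} (hu : 0 ≤ u) (hv : 0 ≤ v) (huv : u + v = 1) :
    leakage b P (fun x y z => u * W₁ x y z + v * W₂ x y z) ≤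
      u * leakage b P W₁ + v * leakage b P W₂ := by
  rw [leakage_eq b hP h₁, leakage_eq b hP h₂, leakage_eq b hP (h₁.combo h₂ hu hv huv),
    ← mul_div_assoc, ← mul_div_assoc, ← add_div]
  refine div_le_div_of_nonneg_right ?_ (Real.log_pos hb).le
  have h := condEntropy_add_le (q₁ := fun y z => u * outLaw P W₁ y z)
    (q₂ := fun y z => v * outLaw P W₂ y z)
    (fun y z => mul_nonneg hu (outLaw_nonneg hP h₁ y z))
    (fun y z => mul_nonneg hv (outLaw_nonneg hP h₂ y z))
  rw [condEntropy_smul, condEntropy_smul] at h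
  have e : outLaw P (fun x y z => u * W₁ x y z + v * W₂ x y z) =
      fun y z => u * outLaw P W₁ y z + v * outLaw P W₂ y z := by
    funext y z
    simp only [outLaw, Finset.mul_sum, ← Finset.sum_add_distrib]
    exact Finset.sum_congr rfl fun x _ => by ring
  rw [e]
  have : privEntropy P = u * privEntropy P + v * privEntropy P := by rw [← add_mul, huv, one_mul]
  linarith

/-- Leakages of the mechanisms with expected cost at most `t`. -/
def mechanismLeakages (b : ℝ) (P : A × B → ℝ) (c : A → C → ℝ) (t : ℝ) : Set ℝ :=
  {r | ∃ W : A → B → C → ℝ, IsMechanism W ∧ expectedCost P W c ≤ t ∧ r = leakage b P W}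

lemma isCompact_mechanismLeakages (b : ℝ) {P : A × B → ℝ} (hP : ∀ p, 0 ≤ P p) (c : A → C → ℝ)
    (t : ℝ) : IsCompact (mechanismLeakages b P c t) := by
  have : mechanismLeakages b P c t = (fun W : A → B → C → ℝ => leakage b P W) ''
      ({W | IsMechanism W} ∩ {W | expectedCost P W c ≤ t}) := by
    ext r
    constructor
    · rintro ⟨W, h1, h2, rfl⟩
      exact ⟨W, ⟨h1, h2⟩, rfl⟩
    · rintro ⟨W, ⟨h1, h2⟩, rfl⟩
      exact ⟨W, h1, h2, rfl⟩
  rw [this]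
  refine (isCompact_isMechanism.inter_right ?_).image_of_continuousOn
    ((continuousOn_leakage b hP).mono inter_subset_left)
  exact isClosed_le (continuous_expectedCost P c) continuous_const

lemma bddBelow_mechanismLeakages (b : ℝ) {P : A × B → ℝ} (hP : ∀ p, 0 ≤ P p) (c : A → C → ℝ)
    (t : ℝ) : BddBelow (mechanismLeakages b P c t) :=
  (isCompact_mechanismLeakages b hP c t).bddBelow

lemma sInf_mechanismLeakages_le (b : ℝ) {P : A × B → ℝ} (hP : ∀ p, 0 ≤ P p) {c : A → C → ℝ}
    {t : ℝ} {W : A → B → C → ℝ} (hW : IsMechanism W) (hc : expectedCost P W c ≤ t) :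
    sInf (mechanismLeakages b P c t) ≤ leakage b P W :=
  csInf_le (bddBelow_mechanismLeakages b hP c t) ⟨W, hW, hc, rfl⟩

lemma exists_leakage_eq_sInf (b : ℝ) {P : A × B → ℝ} (hP : ∀ p, 0 ≤ P p) {c : A → C → ℝ}
    {t : ℝ} (hne : ∃ W : A → B → C → ℝ, IsMechanism W ∧ expectedCost P W c ≤ t) :
    ∃ W : A → B → C → ℝ, IsMechanism W ∧ expectedCost P W c ≤ t ∧
      leakage b P W = sInf (mechanismLeakages b P c t) := by
  obtain ⟨W₀, h0, h0'⟩ := hne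
  obtain ⟨W, h1, h2, h3⟩ := ((isCompact_mechanismLeakages b hP c t).isLeast_sInf
    ⟨_, W₀, h0, h0', rfl⟩).1
  exact ⟨W, h1, h2, h3.symm⟩

/-- Mix two optimal mechanisms: cost is linear, leakage convex. As `singleLetterLeakages` unfolds to
`mechanismLeakages`, this is also the convexity of `L`. -/
lemma sInf_mechanismLeakages_combo_le {b : ℝ} (hb : 1 < b) {P : A × B → ℝ} (hP : ∀ p, 0 ≤ P p)
    {c : A → C → ℝ} {t₁ t₂ : ℝ}
    (h₁ : ∃ W : A → B → C → ℝ, IsMechanism W ∧ expectedCost P W c ≤ t₁)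
    (h₂ : ∃ W : A → B → C → ℝ, IsMechanism W ∧ expectedCost P W c ≤ t₂)
    {u v : ℝ} (hu : 0 ≤ u) (hv : 0 ≤ v) (huv : u + v = 1) :
    sInf (mechanismLeakages b P c (u * t₁ + v * t₂)) ≤
      u * sInf (mechanismLeakages b P c t₁) + v * sInf (mechanismLeakages b P c t₂) := by
  obtain ⟨W₁, m₁, c₁, e₁⟩ := exists_leakage_eq_sInf b hP h₁
  obtain ⟨W₂, m₂, c₂, e₂⟩ := exists_leakage_eq_sInf b hP h₂
  rw [← e₁, ← e₂]
  refine (sInf_mechanismLeakages_le b hP (m₁.combo m₂ hu hv huv) ?_).trans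
    (leakage_combo_le hb hP m₁ m₂ hu hv huv)
  rw [expectedCost_combo]
  exact add_le_add (mul_le_mul_of_nonneg_left c₁ hu) (mul_le_mul_of_nonneg_left c₂ hv)

/-- The mechanism releasing `g x`. -/
noncomputable def detMechanism (B : Type*) (g : A → C) : A → B → C → ℝ :=
  open Classical in fun x _ z => if z = g x then 1 else 0

omit [Fintype A] [Fintype B] in
lemma isMechanism_detMechanism (g : A → C) : IsMechanism (detMechanism B g) := by
  classical
  refine fun x y => ⟨fun z => ?_, ?_⟩
  · unfold detMechanism
    split_ifs <;> norm_num
  · simp [detMechanism]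

lemma expectedCost_detMechanism (P : A × B → ℝ) (g : A → C) (c : A → C → ℝ) :
    expectedCost P (detMechanism B g) c = ∑ x, ∑ y, P (x, y) * c x (g x) := by
  classical
  simp [expectedCost, detMechanism]

end

/-! ### Moments and entropy of product measures. -/

section

variable {A : Type*} [Fintype A] {n : ℕ}

lemma sum_pi_prod (φ : Fin n → A → ℝ) : ∑ a : Fin n → A, ∏ i, φ i (a i) = ∏ i, ∑ a, φ i a := by
  classical
  rw [Finset.prod_univ_sum, Fintype.piFinset_univ]

lemma sum_iid_eq_one {ρ : A → ℝ} (hρ : ∑ a, ρ a = 1) : ∑ a : Fin n → A, ∏ i, ρ (a i) = 1 := by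
  rw [sum_pi_prod (fun _ => ρ)]
  simp [hρ]

lemma sum_iid_apply {ρ : A → ℝ} (hρ : ∑ a, ρ a = 1) (g : A → ℝ) (j : Fin n) :
    ∑ a : Fin n → A, (∏ i, ρ (a i)) * g (a j) = ∑ a, ρ a * g a := by
  -- `g (a j)` is a product over all `i` with factor `1` away from `j`, so the sum factorizes.
  have h := sum_pi_prod (fun i a => ρ a * if i = j then g a else 1)
  simp only [Finset.prod_mul_distrib, Finset.prod_ite_eq', Finset.mem_univ, if_true] at h
  rw [h, Finset.prod_eq_single j]
  · simp
  · intro i _ hi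
    simp [hi, hρ]
  · simp

lemma sum_iid_sum {ρ : A → ℝ} (hρ : ∑ a, ρ a = 1) (g : A → ℝ) :
    ∑ a : Fin n → A, (∏ i, ρ (a i)) * ∑ j, g (a j) = n * ∑ a, ρ a * g a := by
  simp only [Finset.mul_sum]
  rw [Finset.sum_comm]
  simp only [← Finset.mul_sum, sum_iid_apply hρ]
  simp

lemma sum_iid_apply_mul_apply (ρ : A → ℝ) (g : A → ℝ)
    (hg : ∑ a, ρ a * g a = 0) {j k : Fin n} (hjk : j ≠ k) :
    ∑ a : Fin n → A, (∏ i, ρ (a i)) * (g (a j) * g (a k)) = 0 := by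
  have h := sum_pi_prod
    (fun i a => ρ a * ((if i = j then g a else 1) * if i = k then g a else 1))
  simp only [Finset.prod_mul_distrib, Finset.prod_ite_eq', Finset.mem_univ, if_true] at h
  rw [h]
  refine Finset.prod_eq_zero (Finset.mem_univ j) ?_
  simp [hjk, hg]

/-- The variance of a sum of independent copies of a centred variable. -/
lemma sum_iid_sq {ρ : A → ℝ} (hρ : ∑ a, ρ a = 1) (g : A → ℝ) (hg : ∑ a, ρ a * g a = 0) :
    ∑ a : Fin n → A, (∏ i, ρ (a i)) * (∑ j, g (a j)) ^ 2 = n * ∑ a, ρ a * g a ^ 2 := by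
  simp only [sq, Finset.sum_mul_sum]
  simp only [Finset.mul_sum]
  rw [Finset.sum_comm]
  have : ∀ j : Fin n, ∑ a : Fin n → A, ∑ k, (∏ i, ρ (a i)) * (g (a j) * g (a k)) =
      ∑ a, ρ a * (g a * g a) := by
    intro j
    rw [Finset.sum_comm, Finset.sum_eq_single j]
    · exact sum_iid_apply hρ (fun a => g a * g a) j
    · intro k _ hk
      exact sum_iid_apply_mul_apply ρ g hg hk.symm
    · simp
  rw [Finset.sum_congr rfl fun j _ => this j]
  simp [Finset.mul_sum]

lemma sum_negMulLog_iid {ρ : A → ℝ} (hρ : ∑ a, ρ a = 1) :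
    ∑ a : Fin n → A, Real.negMulLog (∏ i, ρ (a i)) = n * ∑ a, Real.negMulLog (ρ a) := by
  have h := sum_iid_sum (n := n) hρ (fun a => -Real.log (ρ a))
  have e : ∀ a, ρ a * -Real.log (ρ a) = Real.negMulLog (ρ a) := fun a => by
    simp [Real.negMulLog]
  simp only [e] at h
  rw [← h]
  refine Finset.sum_congr rfl fun a _ => ?_
  -- The logarithm splits the product only when no factor vanishes; otherwise both sides are `0`.
  by_cases h0 : ∀ i, ρ (a i) ≠ 0
  · rw [Real.negMulLog, Real.log_prod fun i _ => h0 i]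
    simp [Finset.sum_neg_distrib]
  · push Not at h0
    obtain ⟨i, hi⟩ := h0
    rw [Finset.prod_eq_zero (Finset.mem_univ i) hi]
    simp

end

/-! ### Tensorization for memoryless mechanisms. -/

section

variable {X Y Z : Type*} [Fintype X] [Fintype Y] [Fintype Z] {n : ℕ}

lemma sum_sum_pi (F : (Fin n → X) → (Fin n → Y) → ℝ) :
    ∑ x, ∑ y, F x y = ∑ a : Fin n → X × Y, F (fun i => (a i).1) (fun i => (a i).2) := by
  rw [← Fintype.sum_prod_type' (f := F)]
  exact (Fintype.sum_equiv (Equiv.arrowProdEquivProdArrow (Fin n) (fun _ => X) (fun _ => Y)) _ _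
    fun a => rfl).symm

lemma sum_sum_sum_pi (F : (Fin n → X) → (Fin n → Y) → (Fin n → Z) → ℝ) :
    ∑ x, ∑ y, ∑ z, F x y z = ∑ a : Fin n → X × Y × Z,
      F (fun i => (a i).1) (fun i => (a i).2.1) (fun i => (a i).2.2) := by
  simp only [sum_sum_pi (X := Y) (Y := Z)]
  exact sum_sum_pi (X := X) (Y := Y × Z) fun x yz => F x (fun i => (yz i).1) (fun i => (yz i).2)

lemma sum_sum_eq_one {P : X × Y → ℝ} (hP : P ∈ stdSimplex ℝ (X × Y)) :
    ∑ x, ∑ y, P (x, y) = 1 := by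
  rw [← Fintype.sum_prod_type' (f := fun x y => P (x, y))]
  exact hP.2

lemma iidSource_mem {P : X × Y → ℝ} (hP : P ∈ stdSimplex ℝ (X × Y)) (n : ℕ) :
    iidSource P n ∈ stdSimplex ℝ ((Fin n → X) × (Fin n → Y)) := by
  refine ⟨fun p => Finset.prod_nonneg fun i _ => hP.1 _, ?_⟩
  rw [Fintype.sum_prod_type, sum_sum_pi (fun x y => iidSource P n (x, y))]
  exact sum_iid_eq_one hP.2

omit [Fintype Y] in
lemma sum_iidSource_left (P : X × Y → ℝ) (y : Fin n → Y) :
    ∑ x, iidSource P n (x, y) = ∏ i, ∑ x, P (x, y i) :=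
  sum_pi_prod (fun i x => P (x, y i))

lemma privEntropy_iidSource {P : X × Y → ℝ} (hP : P ∈ stdSimplex ℝ (X × Y)) (n : ℕ) :
    privEntropy (iidSource P n) = n * privEntropy P := by
  unfold privEntropy
  simp only [sum_iidSource_left]
  refine sum_negMulLog_iid (ρ := fun y => ∑ x, P (x, y)) ?_
  rw [Finset.sum_comm]
  exact sum_sum_eq_one hP

omit [Fintype X] [Fintype Y] in
lemma isMechanism_memoryless {W : X → Y → Z → ℝ} (hW : IsMechanism W) (n : ℕ) :
    IsMechanism (memoryless W n) := by
  refine fun x y => ⟨fun z => Finset.prod_nonneg fun i _ => hW.nonneg _ _ _, ?_⟩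
  unfold memoryless
  rw [sum_pi_prod (fun i z => W (x i) (y i) z)]
  exact Finset.prod_eq_one fun i _ => hW.sum_eq_one _ _

omit [Fintype Y] [Fintype Z] in
lemma outLaw_memoryless (P : X × Y → ℝ) (W : X → Y → Z → ℝ) (y : Fin n → Y) (z : Fin n → Z) :
    outLaw (iidSource P n) (memoryless W n) y z = ∏ i, outLaw P W (y i) (z i) := by
  unfold outLaw
  rw [← sum_pi_prod (fun i x => P (x, y i) * W x (y i) (z i))]
  simp only [iidSource, memoryless, Finset.prod_mul_distrib]

lemma condEntropy_memoryless {P : X × Y → ℝ} (hP : P ∈ stdSimplex ℝ (X × Y))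
    {W : X → Y → Z → ℝ} (hW : IsMechanism W) (n : ℕ) :
    condEntropy (outLaw (iidSource P n) (memoryless W n)) = n * condEntropy (outLaw P W) := by
  have h1 : ∑ y, ∑ z, outLaw P W y z = 1 := by
    simp only [sum_outLaw P hW]
    rw [Finset.sum_comm]
    exact sum_sum_eq_one hP
  unfold condEntropy
  simp only [outLaw_memoryless]
  rw [mul_sub]
  congr 1
  · rw [sum_sum_pi (fun y z => Real.negMulLog (∏ i, outLaw P W (y i) (z i))),
      sum_negMulLog_iid (ρ := fun p : Y × Z => outLaw P W p.1 p.2), Fintype.sum_prod_type]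
    rw [Fintype.sum_prod_type]
    exact h1
  · have : ∀ z : Fin n → Z, ∑ y : Fin n → Y, ∏ i, outLaw P W (y i) (z i) =
        ∏ i, ∑ y, outLaw P W y (z i) := fun z => sum_pi_prod (fun i y => outLaw P W y (z i))
    simp only [this]
    refine sum_negMulLog_iid (ρ := fun z => ∑ y, outLaw P W y z) ?_
    rw [Finset.sum_comm]
    exact h1

lemma leakage_memoryless (b : ℝ) {P : X × Y → ℝ} (hP : P ∈ stdSimplex ℝ (X × Y))
    {W : X → Y → Z → ℝ} (hW : IsMechanism W) (n : ℕ) :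
    leakage b (iidSource P n) (memoryless W n) = n * leakage b P W := by
  rw [leakage_eq b (iidSource_mem hP n).1 (isMechanism_memoryless hW n), leakage_eq b hP.1 hW,
    privEntropy_iidSource hP, condEntropy_memoryless hP hW]
  ring

/-- Joint law of the public, private and released values. -/
def jointLaw (P : X × Y → ℝ) (W : X → Y → Z → ℝ) (a : X × Y × Z) : ℝ :=
  P (a.1, a.2.1) * W a.1 a.2.1 a.2.2

omit [Fintype X] [Fintype Y] in
lemma jointLaw_nonneg {P : X × Y → ℝ} (hP : ∀ p, 0 ≤ P p) {W : X → Y → Z → ℝ}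
    (hW : IsMechanism W) (a : X × Y × Z) : 0 ≤ jointLaw P W a :=
  mul_nonneg (hP _) (hW.nonneg _ _ _)

lemma sum_jointLaw_mul (P : X × Y → ℝ) (W : X → Y → Z → ℝ) (c : X → Z → ℝ) :
    ∑ a, jointLaw P W a * c a.1 a.2.2 = expectedCost P W c := by
  simp only [Fintype.sum_prod_type]
  rfl

lemma sum_jointLaw {P : X × Y → ℝ} (hP : P ∈ stdSimplex ℝ (X × Y)) {W : X → Y → Z → ℝ}
    (hW : IsMechanism W) : ∑ a, jointLaw P W a = 1 := by
  simp only [Fintype.sum_prod_type, jointLaw, ← Finset.mul_sum, hW.sum_eq_one, mul_one]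
  exact sum_sum_eq_one hP

lemma expectedCost_memoryless (P : X × Y → ℝ) (W : X → Y → Z → ℝ) (n : ℕ)
    (c : (Fin n → X) → (Fin n → Z) → ℝ) :
    expectedCost (iidSource P n) (memoryless W n) c =
      ∑ a : Fin n → X × Y × Z, (∏ i, jointLaw P W (a i)) *
        c (fun i => (a i).1) (fun i => (a i).2.2) := by
  unfold expectedCost
  rw [sum_sum_sum_pi (fun x y z => iidSource P n (x, y) * memoryless W n x y z * c x z)]
  simp only [iidSource, memoryless, jointLaw, Finset.prod_mul_distrib]

end

/-! ### Achievability by memoryless mechanisms. -/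

section

variable {X Y Z : Type*} [Fintype X] [Fintype Y] [Fintype Z]

-- Where `P_X` vanishes any letter will do; one exists because total mass one forces an atom of `P`.
omit [Fintype Z] in
lemma exists_minimal_release {P : X × Y → ℝ} (hP : P ∈ stdSimplex ℝ (X × Y)) {Dmin : ℝ}
    {d : X → Z → ℝ} (hfeas : ∀ x, (∃ y, 0 < P (x, y)) → ∃ z, d x z = Dmin) :
    ∃ g : X → Z, ∀ x y, P (x, y) ≠ 0 → d x (g x) = Dmin := by
  have hpos : ∀ x y, P (x, y) ≠ 0 → ∃ z, d x z = Dmin := fun x y h =>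
    hfeas x ⟨y, lt_of_le_of_ne (hP.1 _) h.symm⟩
  obtain ⟨p, hp⟩ : ∃ p, P p ≠ 0 := by
    by_contra! h
    simpa [h] using hP.2
  obtain ⟨z₀, -⟩ := hpos p.1 p.2 hp
  have : ∀ x, ∃ z, ∀ y, P (x, y) ≠ 0 → d x z = Dmin := by
    intro x
    by_cases h : ∃ y, P (x, y) ≠ 0
    · obtain ⟨y, hy⟩ := h
      obtain ⟨z, hz⟩ := hpos x y hy
      exact ⟨z, fun _ _ => hz⟩
    · push Not at h
      exact ⟨z₀, fun y hy => absurd (h y) hy⟩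
  choose g hg using this
  exact ⟨g, hg⟩

lemma exists_expectedCost_eq_min {P : X × Y → ℝ} (hP : P ∈ stdSimplex ℝ (X × Y)) {Dmin : ℝ}
    {d : X → Z → ℝ} (hfeas : ∀ x, (∃ y, 0 < P (x, y)) → ∃ z, d x z = Dmin) :
    ∃ W : X → Y → Z → ℝ, IsMechanism W ∧ expectedCost P W d = Dmin := by
  obtain ⟨g, hg⟩ := exists_minimal_release hP hfeas
  refine ⟨detMechanism Y g, isMechanism_detMechanism g, ?_⟩
  rw [expectedCost_detMechanism]
  have : ∀ x y, P (x, y) * d x (g x) = P (x, y) * Dmin := by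
    intro x y
    by_cases h : P (x, y) = 0
    · simp [h]
    · rw [hg x y h]
  simp only [this, ← Finset.sum_mul, sum_sum_eq_one hP, one_mul]

omit [Fintype X] [Fintype Z] in
lemma blockDistortion_mem_Icc {Dmin Dmax : ℝ} {d : X → Z → ℝ}
    (hd : ∀ x z, d x z ∈ Icc Dmin Dmax) {n : ℕ} (hn : 1 ≤ n) (x : Fin n → X) (z : Fin n → Z) :
    blockDistortion d n x z ∈ Icc Dmin Dmax := by
  have hn' : (0 : ℝ) < n := by exact_mod_cast hn
  unfold blockDistortion
  constructor
  · rw [le_div_iff₀ hn']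
    have := Finset.card_nsmul_le_sum Finset.univ (fun i => d (x i) (z i)) Dmin
      fun i _ => (hd _ _).1
    simpa [mul_comm] using this
  · rw [div_le_iff₀ hn']
    have := Finset.sum_le_card_nsmul Finset.univ (fun i => d (x i) (z i)) Dmax
      fun i _ => (hd _ _).2
    simpa [mul_comm] using this

/-- A mechanism of minimal expected distortion has minimal distortion almost surely. -/
lemma jointLaw_mul_eq_of_expectedCost_le {P : X × Y → ℝ} (hP : P ∈ stdSimplex ℝ (X × Y))
    {Dmin Dmax : ℝ} {d : X → Z → ℝ} (hd : ∀ x z, d x z ∈ Icc Dmin Dmax) {W : X → Y → Z → ℝ}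
    (hW : IsMechanism W) (hc : expectedCost P W d ≤ Dmin) (a : X × Y × Z)
    (ha : jointLaw P W a ≠ 0) : d a.1 a.2.2 = Dmin := by
  have h0 : ∑ a, jointLaw P W a * (d a.1 a.2.2 - Dmin) ≤ 0 := by
    simp only [mul_sub, Finset.sum_sub_distrib, ← Finset.sum_mul, sum_jointLaw hP hW,
      sum_jointLaw_mul P W d]
    linarith
  have hnn : ∀ a ∈ Finset.univ, 0 ≤ jointLaw P W a * (d a.1 a.2.2 - Dmin) := fun a _ =>
    mul_nonneg (jointLaw_nonneg hP.1 hW a) (sub_nonneg.2 (hd _ _).1)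
  have := (Finset.sum_eq_zero_iff_of_nonneg hnn).1 (le_antisymm h0 (Finset.sum_nonneg hnn)) a
    (Finset.mem_univ a)
  rcases mul_eq_zero.1 this with h | h
  · exact absurd h ha
  · linarith

/-- Gives feasibility for every `n ≥ 1`, and covers the boundary case `f_l⁻¹(t) = Dmin`, where
Chebyshev has no slack. -/
lemma expectedCost_memoryless_of_min {P : X × Y → ℝ} (hP : P ∈ stdSimplex ℝ (X × Y))
    {Dmin Dmax : ℝ} {d : X → Z → ℝ} (hd : ∀ x z, d x z ∈ Icc Dmin Dmax) {W : X → Y → Z → ℝ}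
    (hW : IsMechanism W) (hc : expectedCost P W d ≤ Dmin) (f : ℝ → ℝ) {n : ℕ} (hn : 1 ≤ n) :
    expectedCost (iidSource P n) (memoryless W n) (fun x z => f (blockDistortion d n x z)) =
      f Dmin := by
  rw [expectedCost_memoryless]
  have : ∀ a : Fin n → X × Y × Z, (∏ i, jointLaw P W (a i)) *
      f (blockDistortion d n (fun i => (a i).1) (fun i => (a i).2.2)) =
      (∏ i, jointLaw P W (a i)) * f Dmin := by
    intro a
    by_cases h : ∏ i, jointLaw P W (a i) = 0
    · simp [h]
    congr 2
    have h' : ∀ i, d (a i).1 (a i).2.2 = Dmin := fun i =>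
      jointLaw_mul_eq_of_expectedCost_le hP hd hW hc (a i)
        fun h0 => h (Finset.prod_eq_zero (Finset.mem_univ i) h0)
    have hn' : (n : ℝ) ≠ 0 := by positivity
    simp only [blockDistortion, h', Finset.sum_const, Finset.card_univ, Fintype.card_fin,
      nsmul_eq_mul]
    field_simp
  simp only [this, ← Finset.sum_mul, sum_iid_eq_one (sum_jointLaw hP hW), one_mul]

/-- Chebyshev's inequality: a memoryless mechanism of expected distortion below `D` has block cost
asymptotically at most `f D`. -/
lemma eventually_expectedCost_memoryless_le {P : X × Y → ℝ} (hP : P ∈ stdSimplex ℝ (X × Y))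
    {Dmin Dmax : ℝ} {d : X → Z → ℝ} (hd : ∀ x z, d x z ∈ Icc Dmin Dmax) {f : ℝ → ℝ}
    (hf_nonneg : ∀ D ∈ Icc Dmin Dmax, 0 ≤ f D) (hf_mono : MonotoneOn f (Icc Dmin Dmax))
    {W : X → Y → Z → ℝ} (hW : IsMechanism W) {D t : ℝ} (hD : D ∈ Icc Dmin Dmax)
    (hWD : expectedCost P W d < D) (hfD : f D < t) :
    ∀ᶠ n : ℕ in atTop, expectedCost (iidSource P n) (memoryless W n)
      (fun x z => f (blockDistortion d n x z)) ≤ t := by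
  set m := expectedCost P W d with hm
  have hmax : Dmax ∈ Icc Dmin Dmax := ⟨hD.1.trans hD.2, le_rfl⟩
  set g : X × Y × Z → ℝ := fun a => d a.1 a.2.2 - m with hg
  set V := ∑ a, jointLaw P W a * g a ^ 2 with hV
  -- Chosen so that `c * (B - m) ^ 2 ≥ f Dmax` as soon as the block distortion `B` is at least `D`.
  set c := f Dmax / (D - m) ^ 2 with hc
  have hc0 : 0 ≤ c := div_nonneg (hf_nonneg _ hmax) (sq_nonneg _)
  have hg0 : ∑ a, jointLaw P W a * g a = 0 := by
    simp only [hg, mul_sub, Finset.sum_sub_distrib, ← Finset.sum_mul, sum_jointLaw hP hW,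
      sum_jointLaw_mul P W d]
    simp [hm]
  have hlim : Tendsto (fun n : ℕ => f D + c * V / n) atTop (𝓝 (f D)) := by
    simpa using (tendsto_const_div_atTop_nhds_zero_nat (c * V)).const_add (f D)
  filter_upwards [hlim.eventually_lt_const hfD, eventually_ge_atTop 1] with n hn hn1
  refine le_trans ?_ hn.le
  have hn' : (0 : ℝ) < n := by exact_mod_cast hn1
  rw [expectedCost_memoryless]
  have hpt : ∀ a : Fin n → X × Y × Z,
      f (blockDistortion d n (fun i => (a i).1) (fun i => (a i).2.2)) ≤
        f D + c / n ^ 2 * (∑ i, g (a i)) ^ 2 := by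
    intro a
    have hmem := blockDistortion_mem_Icc hd hn1 (fun i => (a i).1) (fun i => (a i).2.2)
    set B := blockDistortion d n (fun i => (a i).1) (fun i => (a i).2.2) with hB
    have hsum : ∑ i, g (a i) = n * (B - m) := by
      simp only [hg, Finset.sum_sub_distrib, hB, blockDistortion]
      simp
      field_simp
    have hrw : c / n ^ 2 * (∑ i, g (a i)) ^ 2 = c * (B - m) ^ 2 := by
      rw [hsum]
      field_simp
    rw [hrw]
    rcases le_total B D with h | h
    · have := hf_mono hmem hD h
      nlinarith [mul_nonneg hc0 (sq_nonneg (B - m))]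
    · have h1 := hf_mono hmem hmax hmem.2
      have h2 : f Dmax ≤ c * (B - m) ^ 2 := by
        rw [hc, div_mul_eq_mul_div, le_div_iff₀ (pow_pos (sub_pos.2 hWD) 2)]
        refine mul_le_mul_of_nonneg_left ?_ (hf_nonneg _ hmax)
        exact pow_le_pow_left₀ (sub_pos.2 hWD).le (by linarith) 2
      linarith [hf_nonneg D hD]
  calc _ ≤ ∑ a : Fin n → X × Y × Z, (∏ i, jointLaw P W (a i)) *
        (f D + c / n ^ 2 * (∑ i, g (a i)) ^ 2) :=
        Finset.sum_le_sum fun a _ => mul_le_mul_of_nonneg_left (hpt a)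
          (Finset.prod_nonneg fun i _ => jointLaw_nonneg hP.1 hW _)
    _ = f D + c * V / n := by
        simp only [mul_add, Finset.sum_add_distrib, ← Finset.sum_mul,
          sum_iid_eq_one (sum_jointLaw hP hW), one_mul, mul_left_comm _ (c / (n : ℝ) ^ 2),
          ← Finset.mul_sum, sum_iid_sq (sum_jointLaw hP hW) g hg0]
        rw [hV]
        field_simp

/-- By `leakage_memoryless` the objective is a multiple of the single-letter leakage, and the cost
is polynomial in the entries of `W`. -/
lemma isCompact_memorylessLeakages (b : ℝ) {P : X × Y → ℝ} (hP : P ∈ stdSimplex ℝ (X × Y))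
    (d : X → Z → ℝ) (f : ℝ → ℝ) (t : ℝ) (n : ℕ) : IsCompact (memorylessLeakages b P d f t n) := by
  have : memorylessLeakages b P d f t n =
      (fun W : X → Y → Z → ℝ => 1 / (n : ℝ) * (n * leakage b P W)) ''
      ({W | IsMechanism W} ∩ {W | expectedCost (iidSource P n) (memoryless W n)
        (fun x z => f (blockDistortion d n x z)) ≤ t}) := by
    ext r
    constructor
    · rintro ⟨W, h1, h2, rfl⟩
      exact ⟨W, ⟨h1, h2⟩, by simp only [leakage_memoryless b hP h1 n]⟩
    · rintro ⟨W, ⟨h1, h2⟩, rfl⟩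
      exact ⟨W, h1, h2, by simp only [leakage_memoryless b hP h1 n]⟩
  rw [this]
  refine (isCompact_isMechanism.inter_right (isClosed_le ?_ continuous_const)).image_of_continuousOn
    (((continuousOn_leakage b hP.1).const_mul _).const_mul _ |>.mono inter_subset_left)
  refine (continuous_expectedCost (iidSource P n) _).comp ?_
  unfold memoryless
  fun_prop

lemma memorylessLeakage_le (b : ℝ) {P : X × Y → ℝ} (hP : P ∈ stdSimplex ℝ (X × Y))
    {d : X → Z → ℝ} {f : ℝ → ℝ} {t : ℝ} {n : ℕ} (hn : 1 ≤ n) {W : X → Y → Z → ℝ}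
    (hW : IsMechanism W) (hc : expectedCost (iidSource P n) (memoryless W n)
      (fun x z => f (blockDistortion d n x z)) ≤ t) :
    memorylessLeakage b P d f t n ≤ leakage b P W := by
  refine csInf_le (isCompact_memorylessLeakages b hP d f t n).bddBelow ⟨W, hW, hc, ?_⟩
  have hn' : (n : ℝ) ≠ 0 := by positivity
  rw [leakage_memoryless b hP hW]
  field_simp

lemma nonempty_memorylessLeakages (b : ℝ) {P : X × Y → ℝ} (hP : P ∈ stdSimplex ℝ (X × Y))
    {Dmin Dmax : ℝ} {d : X → Z → ℝ} (hd : ∀ x z, d x z ∈ Icc Dmin Dmax)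
    (hfeas : ∀ x, (∃ y, 0 < P (x, y)) → ∃ z, d x z = Dmin) {f : ℝ → ℝ} {t : ℝ} (ht : f Dmin < t)
    {n : ℕ} (hn : 1 ≤ n) : (memorylessLeakages b P d f t n).Nonempty := by
  obtain ⟨W, hW, hc⟩ := exists_expectedCost_eq_min hP hfeas
  exact ⟨_, W, hW, (expectedCost_memoryless_of_min hP hd hW hc.le f hn).trans_le ht.le, rfl⟩

lemma lowerInv_mem_Icc {Dmin Dmax : ℝ} (h : Dmin ≤ Dmax) {f : ℝ → ℝ} {t : ℝ} (ht : f Dmin < t) :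
    lowerInv Dmin Dmax f t ∈ Icc Dmin Dmax :=
  ⟨le_csSup ⟨Dmax, fun _ hx => hx.1.2⟩ ⟨⟨le_rfl, h⟩, ht⟩,
    csSup_le ⟨Dmin, ⟨le_rfl, h⟩, ht⟩ fun _ hx => hx.1.2⟩

lemma exists_mechanism_of_mem_Icc {P : X × Y → ℝ} (hP : P ∈ stdSimplex ℝ (X × Y)) {Dmin : ℝ}
    {d : X → Z → ℝ} (hfeas : ∀ x, (∃ y, 0 < P (x, y)) → ∃ z, d x z = Dmin) {D : ℝ}
    (hD : Dmin ≤ D) : ∃ W : X → Y → Z → ℝ, IsMechanism W ∧ expectedCost P W d ≤ D := by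
  obtain ⟨W, hW, hc⟩ := exists_expectedCost_eq_min hP hfeas
  exact ⟨W, hW, hc.le.trans hD⟩

lemma singleLetterLeakage_nonneg {b : ℝ} (hb : 1 < b) {P : X × Y → ℝ}
    (hP : P ∈ stdSimplex ℝ (X × Y)) (d : X → Z → ℝ) (D : ℝ) :
    0 ≤ singleLetterLeakage b P d D := by
  refine Real.sInf_nonneg ?_
  rintro _ ⟨W, hW, -, rfl⟩
  exact leakage_nonneg hb hP hW

/-- Memoryless mechanisms asymptotically achieve the single-letter leakage at the lower inverse of
the cost function. -/
lemma eventually_memorylessLeakage_le {b : ℝ} (hb : 1 < b) {P : X × Y → ℝ}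
    (hP : P ∈ stdSimplex ℝ (X × Y)) {Dmin Dmax : ℝ} (hDD : Dmin ≤ Dmax) {d : X → Z → ℝ}
    (hd : ∀ x z, d x z ∈ Icc Dmin Dmax)
    (hfeas : ∀ x, (∃ y, 0 < P (x, y)) → ∃ z, d x z = Dmin) {f : ℝ → ℝ}
    (hf_nonneg : ∀ D ∈ Icc Dmin Dmax, 0 ≤ f D) (hf_mono : MonotoneOn f (Icc Dmin Dmax))
    {t : ℝ} (ht : f Dmin < t) {ε : ℝ} (hε : 0 < ε) :
    ∀ᶠ n : ℕ in atTop, memorylessLeakage b P d f t n ≤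
      singleLetterLeakage b P d (lowerInv Dmin Dmax f t) + ε := by
  obtain ⟨hD1, hD2⟩ := lowerInv_mem_Icc hDD ht
  set D₀ := lowerInv Dmin Dmax f t with hD₀
  have hne : ∀ D, Dmin ≤ D → ∃ W : X → Y → Z → ℝ, IsMechanism W ∧ expectedCost P W d ≤ D :=
    fun D => exists_mechanism_of_mem_Icc hP hfeas
  rcases hD1.eq_or_lt with h | h
  · obtain ⟨W, hW, hc, he⟩ := exists_leakage_eq_sInf b hP.1 (hne D₀ hD1)
    filter_upwards [eventually_ge_atTop 1] with n hn
    have := memorylessLeakage_le b hP (f := f) (t := t) hn hW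
      ((expectedCost_memoryless_of_min hP hd hW (hc.trans h.symm.le) f hn).trans_le ht.le)
    rw [he] at this
    exact this.trans (le_add_of_nonneg_right hε.le)
  · set L := singleLetterLeakage b P d with hL
    have hL0 : ∀ D, 0 ≤ L D := singleLetterLeakage_nonneg hb hP d
    -- Moving from `D₀` towards `Dmin` with weight `u` opens the strict gap `D₁ < D₀` and raises `L`
    -- by at most `u * L Dmin ≤ ε`. The `+ 1` keeps the denominator positive.
    set u := min 1 (ε / (L Dmin + 1)) with hu
    have hpos : 0 < L Dmin + 1 := by linarith [hL0 Dmin]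
    have hu0 : 0 < u := lt_min one_pos (div_pos hε hpos)
    have hu1 : u ≤ 1 := min_le_left _ _
    have huε : u * (L Dmin + 1) ≤ ε := by
      rw [← le_div_iff₀ hpos]
      exact min_le_right _ _
    set D₁ := u * Dmin + (1 - u) * D₀ with hD₁
    have hD₁min : Dmin ≤ D₁ := by nlinarith
    have hD₁lt : D₁ < D₀ := by nlinarith
    have hcv : L D₁ ≤ u * L Dmin + (1 - u) * L D₀ :=
      sInf_mechanismLeakages_combo_le hb hP.1 (hne _ le_rfl) (hne _ hD1) hu0.le
        (sub_nonneg.2 hu1) (by ring)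
    obtain ⟨W, hW, hc, he⟩ := exists_leakage_eq_sInf b hP.1 (hne D₁ hD₁min)
    -- Such a `D'` exists whether or not the supremum `D₀` is attained.
    obtain ⟨D', ⟨hD'mem, hfD'⟩, hD'⟩ := exists_lt_of_lt_csSup
      (⟨Dmin, ⟨le_rfl, hDD⟩, ht⟩ : {D | D ∈ Icc Dmin Dmax ∧ f D < t}.Nonempty) hD₁lt
    filter_upwards [eventually_ge_atTop 1, eventually_expectedCost_memoryless_le hP hd hf_nonneg
      hf_mono hW hD'mem (hc.trans_lt hD') hfD'] with n hn hcost
    have := memorylessLeakage_le b hP hn hW hcost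
    have h2 : leakage b P W = L D₁ := he
    nlinarith [hL0 D₀]

end

/-! ### Converse: single-letter entropy bound. -/

section

variable {B C : Type*} [Fintype B] [Fintype C]

/-- Single-letter bound on the conditional entropy of a sum of `K` measures on sequences, in terms
of the sums `ν k` of their letter marginals. -/
lemma condEntropy_sum_le {K n : ℕ} (hK : 0 < K) (q : Fin K → (Fin n → B) → (Fin n → C) → ℝ)
    (hq : ∀ k y z, 0 ≤ q k y z) (ν : Fin K → B → C → ℝ) (hν : ∀ k y z, 0 ≤ ν k y z)
    (hqν : ∀ k (g : B → C → ℝ),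
      ∑ y, ∑ z, ν k y z * g y z = ∑ y, ∑ z, q k y z * ∑ i, g (y i) (z i)) :
    condEntropy (fun y z => ∑ k, q k y z) ≤
      ∑ k, condEntropy (ν k) + (∑ k, ∑ y, ∑ z, q k y z) * Real.log K := by
  classical
  have hK' : (0 : ℝ) < K := by exact_mod_cast hK
  have hprod : ∀ k (y : Fin n → B) (z : Fin n → C), 0 ≤ ∏ i, condKernel (ν k) (y i) (z i) :=
    fun k y z => Finset.prod_nonneg fun i _ => condKernel_nonneg (hν k) _ _
  have hzero : ∀ k (y : Fin n → B) (z : Fin n → C), ∏ i, condKernel (ν k) (y i) (z i) = 0 →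
      q k y z = 0 := by
    intro k y z h
    obtain ⟨i, -, hi⟩ := Finset.prod_eq_zero_iff.1 h
    have h0 := eq_zero_of_condKernel_eq_zero (hν k) hi
    -- Test on the indicator of the pair `(y i, z i)`: a sequence passing through a pair of zero `ν
    -- k`-mass has zero `q k`-mass.
    have h1 := hqν k fun y' z' => if y' = y i ∧ z' = z i then 1 else 0
    have h2 : ∑ y', ∑ z', ν k y' z' * (if y' = y i ∧ z' = z i then (1 : ℝ) else 0) = 0 := by
      refine Finset.sum_eq_zero fun y' _ => Finset.sum_eq_zero fun z' _ => ?_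
      split_ifs with hc
      · rw [hc.1, hc.2, h0, zero_mul]
      · rw [mul_zero]
    have hin : ∀ (y' : Fin n → B) (z' : Fin n → C),
        0 ≤ ∑ j, if y' j = y i ∧ z' j = z i then (1 : ℝ) else 0 := fun y' z' =>
      Finset.sum_nonneg fun j _ => by split_ifs <;> norm_num
    have hnn : ∀ (y' : Fin n → B) (z' : Fin n → C),
        0 ≤ q k y' z' * ∑ j, if y' j = y i ∧ z' j = z i then (1 : ℝ) else 0 := fun y' z' =>
      mul_nonneg (hq k y' z') (hin y' z')
    rw [h2] at h1
    have h3 := (Finset.sum_eq_zero_iff_of_nonneg fun y' _ =>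
      Finset.sum_nonneg fun z' _ => hnn y' z').1 h1.symm y (Finset.mem_univ y)
    have h4 := (Finset.sum_eq_zero_iff_of_nonneg fun z' _ => hnn y z').1 h3 z (Finset.mem_univ z)
    rcases mul_eq_zero.1 h4 with h5 | h5
    · exact h5
    · have := (Finset.sum_eq_zero_iff_of_nonneg
        fun j _ => by split_ifs <;> norm_num).1 h5 i (Finset.mem_univ i)
      simp at this
  -- The competitor is the uniform mixture of the `K` product kernels. It dominates each of them
  -- divided by `K`, which costs `log K`.
  set κ : (Fin n → B) → (Fin n → C) → ℝ := fun y z =>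
    (∑ k, ∏ i, condKernel (ν k) (y i) (z i)) / K with hκ
  have hκk : ∀ k y z, κ y z = 0 → q k y z = 0 := by
    intro k y z h
    refine hzero k y z ?_
    rcases div_eq_zero_iff.1 h with h | h
    · exact (Finset.sum_eq_zero_iff_of_nonneg fun k _ => hprod k y z).1 h k (Finset.mem_univ k)
    · exact absurd h hK'.ne'
  have h1 := condEntropy_le (fun y z => ∑ k, q k y z) κ
    (fun y z => Finset.sum_nonneg fun k _ => hq k y z)
    (fun y z => div_nonneg (Finset.sum_nonneg fun k _ => hprod k y z) hK'.le)
    (fun z => by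
      simp only [hκ, ← Finset.sum_div]
      rw [div_le_one hK', Finset.sum_comm]
      refine (Finset.sum_le_card_nsmul _ _ 1 fun k _ => ?_).trans_eq (by simp)
      rw [sum_pi_prod (fun i y => condKernel (ν k) y (z i))]
      exact Finset.prod_le_one (fun i _ => Finset.sum_nonneg fun y _ =>
        condKernel_nonneg (hν k) _ _) fun i _ => sum_condKernel_le _ _)
    (fun y z h => Finset.sum_eq_zero fun k _ => hκk k y z h)
  refine h1.trans ?_
  have hpt : ∀ k y z, -(q k y z * Real.log (κ y z)) ≤
      -(q k y z * ∑ i, Real.log (condKernel (ν k) (y i) (z i))) + q k y z * Real.log K := by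
    intro k y z
    by_cases h0 : q k y z = 0
    · simp [h0]
    have hp : ∏ i, condKernel (ν k) (y i) (z i) ≠ 0 := fun h => h0 (hzero k y z h)
    have hle : (∏ i, condKernel (ν k) (y i) (z i)) / K ≤ κ y z :=
      div_le_div_of_nonneg_right (Finset.single_le_sum
        (f := fun k => ∏ i, condKernel (ν k) (y i) (z i)) (fun k _ => hprod k y z)
        (Finset.mem_univ k)) hK'.le
    have hlog := Real.log_le_log (div_pos (lt_of_le_of_ne (hprod k y z) hp.symm) hK') hle
    rw [Real.log_div hp hK'.ne', Real.log_prod (Finset.prod_ne_zero_iff.1 hp)] at hlog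
    nlinarith [hq k y z]
  have h2 : -∑ y, ∑ z, (∑ k, q k y z) * Real.log (κ y z) =
      ∑ k, ∑ y, ∑ z, -(q k y z * Real.log (κ y z)) := by
    simp only [Finset.sum_mul, Finset.sum_neg_distrib]
    rw [Finset.sum_comm (γ := Fin K)]
    refine congrArg _ (Finset.sum_congr rfl fun y _ => ?_)
    rw [Finset.sum_comm]
  rw [h2]
  refine (Finset.sum_le_sum fun k _ => Finset.sum_le_sum fun y _ => Finset.sum_le_sum fun z _ =>
    hpt k y z).trans_eq ?_
  simp only [Finset.sum_add_distrib, ← Finset.sum_mul, Finset.sum_neg_distrib]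
  congr 1
  rw [← Finset.sum_neg_distrib]
  refine Finset.sum_congr rfl fun k _ => ?_
  rw [condEntropy_eq (hν k), hqν k fun y z => Real.log (condKernel (ν k) y z)]

end

/-! ### Converse: letter laws and stability under source deviation. -/

section

variable {S : Type*} [Fintype S] {n : ℕ}

/-- The average of the letter marginals of the measure `m` on sequences. -/
noncomputable def letterLaw (m : (Fin n → S) → ℝ) (s : S) : ℝ :=
  open Classical in (∑ a, m a * ∑ i, if a i = s then 1 else 0) / n

lemma letterLaw_nonneg {m : (Fin n → S) → ℝ} (hm : ∀ a, 0 ≤ m a) (s : S) :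
    0 ≤ letterLaw m s := by
  classical
  refine div_nonneg (Finset.sum_nonneg fun a _ => mul_nonneg (hm a) ?_) n.cast_nonneg
  exact Finset.sum_nonneg fun i _ => by split_ifs <;> norm_num

lemma sum_letterLaw_mul (m : (Fin n → S) → ℝ) (g : S → ℝ) :
    ∑ s, letterLaw m s * g s = (∑ a, m a * ∑ i, g (a i)) / n := by
  classical
  simp only [letterLaw, div_mul_eq_mul_div, ← Finset.sum_div]
  congr 1
  simp only [Finset.sum_mul]
  rw [Finset.sum_comm]
  refine Finset.sum_congr rfl fun a _ => ?_
  simp only [mul_assoc, ← Finset.mul_sum, Finset.sum_mul]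
  rw [Finset.sum_comm]
  simp

lemma sum_letterLaw (hn : 1 ≤ n) (m : (Fin n → S) → ℝ) : ∑ s, letterLaw m s = ∑ a, m a := by
  have h := sum_letterLaw_mul m fun _ => 1
  have hn' : (n : ℝ) ≠ 0 := by positivity
  simp only [mul_one, Finset.sum_const, Finset.card_univ, Fintype.card_fin, nsmul_eq_mul,
    ← Finset.sum_mul] at h
  rw [h]
  field_simp

end

/-- On the compact set where `Φ ≤ v - ε`, `φ` has no zero, so its minimum there serves as `δ`. -/
lemma exists_forall_lt_of_isCompact {E : Type*} [TopologicalSpace E] {C : Set E}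
    (hC : IsCompact C) {φ Φ : E → ℝ} (hφ : Continuous φ) (hΦ : Continuous Φ)
    (hφ0 : ∀ e, 0 ≤ φ e) {v : ℝ} (h : ∀ e ∈ C, φ e = 0 → v ≤ Φ e) {ε : ℝ} (hε : 0 < ε) :
    ∃ δ > 0, ∀ e ∈ C, φ e < δ → v - ε < Φ e := by
  have hS : IsCompact (C ∩ {e | Φ e ≤ v - ε}) :=
    hC.inter_right (isClosed_le hΦ continuous_const)
  rcases (C ∩ {e | Φ e ≤ v - ε}).eq_empty_or_nonempty with he | hne
  · refine ⟨1, one_pos, fun e heC _ => ?_⟩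
    by_contra! hc
    have : e ∈ C ∩ {e | Φ e ≤ v - ε} := ⟨heC, hc⟩
    rw [he] at this
    exact this
  · obtain ⟨e₀, ⟨h0C, h0⟩, hmin⟩ := hS.exists_isMinOn hne hφ.continuousOn
    refine ⟨φ e₀, lt_of_le_of_ne (hφ0 _) fun h1 => ?_, fun e heC hlt => ?_⟩
    · have := h e₀ h0C h1.symm
      have h0' : Φ e₀ ≤ v - ε := h0
      linarith
    · by_contra! hc
      have := hmin (a := e) ⟨heC, hc⟩
      exact absurd hlt (not_lt.2 this)

section

variable {X Y Z : Type*} [Fintype X] [Fintype Y] [Fintype Z]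

/-- Total deviation of the public-private marginals of the measures `μ k` from multiples of `P`. -/
def sourceDeviation {K : ℕ} (P : X × Y → ℝ) (μ : Fin K → X × Y × Z → ℝ) : ℝ :=
  ∑ k, ∑ x, ∑ y, |(∑ z, μ k (x, y, z)) - (∑ s, μ k s) * P (x, y)|

/-- Lower bound on the leakage of a measure whose public-private marginal is a multiple of `P`. -/
lemma mul_singleLetterLeakage_le (b : ℝ) {P : X × Y → ℝ}
    (hP : P ∈ stdSimplex ℝ (X × Y)) {d : X → Z → ℝ} {D : ℝ}
    (hne : ∃ W : X → Y → Z → ℝ, IsMechanism W) {μ : X × Y × Z → ℝ} (hμ : ∀ s, 0 ≤ μ s)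
    (hdev : ∀ x y, ∑ z, μ (x, y, z) = (∑ s, μ s) * P (x, y))
    (hd : ∑ s, μ s * d s.1 s.2.2 ≤ D * ∑ s, μ s) :
    (∑ s, μ s) * singleLetterLeakage b P d D ≤
      ((∑ s, μ s) * privEntropy P - condEntropy (fun y z => ∑ x, μ (x, y, z))) / Real.log b := by
  classical
  obtain ⟨W₀, hW₀⟩ := hne
  set p := ∑ s, μ s with hp
  have hp0 : 0 ≤ p := Finset.sum_nonneg fun s _ => hμ s
  rcases hp0.eq_or_lt with h0 | hpos
  · have hz : ∀ s, μ s = 0 := fun s =>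
      (Finset.sum_eq_zero_iff_of_nonneg fun s _ => hμ s).1 (hp.symm.trans h0.symm) s
        (Finset.mem_univ s)
    rw [← h0]
    simp [hz, condEntropy]
  -- The conditional law of `z` given `(x, y)` under `μ`, with `W₀` as filler off the support of
  -- `P`.
  set W : X → Y → Z → ℝ := fun x y z =>
    if P (x, y) = 0 then W₀ x y z else μ (x, y, z) / (p * P (x, y)) with hWdef
  have hW : IsMechanism W := by
    intro x y
    by_cases h : P (x, y) = 0
    · have : W x y = W₀ x y := by
        funext z
        simp [hWdef, h]
      rw [this]
      exact hW₀ x y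
    · have : W x y = fun z => μ (x, y, z) / (p * P (x, y)) := by
        funext z
        simp [hWdef, h]
      rw [this]
      refine ⟨fun z => div_nonneg (hμ _) (mul_nonneg hp0 (hP.1 _)), ?_⟩
      rw [← Finset.sum_div, hdev x y]
      exact div_self (mul_ne_zero hpos.ne' h)
  have hPW : ∀ x y z, p * (P (x, y) * W x y z) = μ (x, y, z) := by
    intro x y z
    by_cases h : P (x, y) = 0
    · have h1 := hdev x y
      rw [h, mul_zero] at h1
      rw [(Finset.sum_eq_zero_iff_of_nonneg fun z _ => hμ (x, y, z)).1 h1 z (Finset.mem_univ z), h]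
      simp
    · simp only [hWdef, h, if_false]
      field_simp
  have hcost : expectedCost P W d ≤ D := by
    have : p * expectedCost P W d = ∑ s, μ s * d s.1 s.2.2 := by
      simp only [expectedCost, Finset.mul_sum, Fintype.sum_prod_type, ← hPW, mul_assoc]
    rw [← this, mul_comm D] at hd
    exact le_of_mul_le_mul_left hd hpos
  have hL : singleLetterLeakage b P d D ≤ leakage b P W :=
    sInf_mechanismLeakages_le b hP.1 hW hcost
  have hout : (fun y z => ∑ x, μ (x, y, z)) = fun y z => p * outLaw P W y z := by
    funext y z
    simp only [outLaw, Finset.mul_sum, hPW]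
  rw [hout, condEntropy_smul, ← mul_sub, mul_div_assoc, ← leakage_eq b hP.1 hW]
  exact mul_le_mul_of_nonneg_left hL hp0

/-- Stability of the time-sharing lower bound under small deviations of the source law. -/
lemma exists_deviation_bound (b : ℝ) {P : X × Y → ℝ}
    (hP : P ∈ stdSimplex ℝ (X × Y)) (d : X → Z → ℝ) (hne : ∃ W : X → Y → Z → ℝ, IsMechanism W)
    {K : ℕ} (D T : Fin K → ℝ) {τ v : ℝ}
    (hv : ∀ p : Fin K → ℝ, (∀ k, 0 ≤ p k) → ∑ k, p k = 1 → ∑ k, p k * T k ≤ τ →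
      v ≤ ∑ k, p k * singleLetterLeakage b P d (D k)) {ε : ℝ} (hε : 0 < ε) :
    ∃ δ > 0, ∀ μ : Fin K → X × Y × Z → ℝ, (∀ k s, 0 ≤ μ k s) → ∑ k, ∑ s, μ k s = 1 →
      (∀ k, ∑ s, μ k s * d s.1 s.2.2 ≤ D k * ∑ s, μ k s) → ∑ k, (∑ s, μ k s) * T k ≤ τ →
      sourceDeviation P μ < δ →
      v - ε < (privEntropy P - ∑ k, condEntropy (fun y z => ∑ x, μ k (x, y, z))) /
        Real.log b := by
  -- The block length does not appear in `C`, so compactness yields one `δ` for all `n`. The box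
  -- `[0, 1]` is implied by nonnegativity and total mass one.
  set C : Set (Fin K → X × Y × Z → ℝ) :=
    (Set.pi univ fun _ => Set.pi univ fun _ => Icc 0 1) ∩ ({μ | ∑ k, ∑ s, μ k s = 1} ∩
      ({μ | ∀ k, ∑ s, μ k s * d s.1 s.2.2 ≤ D k * ∑ s, μ k s} ∩
        {μ | ∑ k, (∑ s, μ k s) * T k ≤ τ})) with hC
  have hCc : IsCompact C := by
    refine (isCompact_univ_pi fun _ => isCompact_univ_pi fun _ => isCompact_Icc).inter_right ?_
    refine (isClosed_eq (by fun_prop) continuous_const).inter (IsClosed.inter ?_ ?_)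
    · simp only [Set.ofPred_forall]
      exact isClosed_iInter fun k => isClosed_le (by fun_prop) (by fun_prop)
    · exact isClosed_le (by fun_prop) continuous_const
  have hexact : ∀ μ ∈ C, sourceDeviation P μ = 0 → v ≤ (privEntropy P -
      ∑ k, condEntropy (fun y z => ∑ x, μ k (x, y, z))) / Real.log b := by
    rintro μ ⟨h0, h1, h2, h3⟩ hdev
    have h0' : ∀ k s, 0 ≤ μ k s := fun k s => (h0 k trivial s trivial).1
    have hdev' : ∀ k x y, ∑ z, μ k (x, y, z) = (∑ s, μ k s) * P (x, y) := by
      intro k x y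
      have a1 := (Finset.sum_eq_zero_iff_of_nonneg fun k _ => Finset.sum_nonneg fun x _ =>
        Finset.sum_nonneg fun y _ => abs_nonneg _).1 hdev k (Finset.mem_univ k)
      have a2 := (Finset.sum_eq_zero_iff_of_nonneg fun x _ =>
        Finset.sum_nonneg fun y _ => abs_nonneg _).1 a1 x (Finset.mem_univ x)
      have a3 := (Finset.sum_eq_zero_iff_of_nonneg fun y _ => abs_nonneg _).1 a2 y
        (Finset.mem_univ y)
      exact sub_eq_zero.1 (abs_eq_zero.1 a3)
    refine (hv (fun k => ∑ s, μ k s) (fun k => Finset.sum_nonneg fun s _ => h0' k s) h1 h3).trans ?_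
    refine (Finset.sum_le_sum fun k _ =>
      mul_singleLetterLeakage_le b hP hne (h0' k) (hdev' k) (h2 k)).trans_eq ?_
    rw [← Finset.sum_div, Finset.sum_sub_distrib, ← Finset.sum_mul]
    have h1' : ∑ k, ∑ s, μ k s = 1 := h1
    rw [h1', one_mul]
  obtain ⟨δ, hδ, h⟩ := exists_forall_lt_of_isCompact hCc (φ := sourceDeviation P)
    (Φ := fun μ => (privEntropy P - ∑ k, condEntropy (fun y z => ∑ x, μ k (x, y, z))) /
        Real.log b) (v := v)
    (by unfold sourceDeviation; fun_prop)
    (by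
      refine (continuous_const.sub (continuous_finsetSum _ fun k _ => ?_)).div_const _
      exact continuous_condEntropy.comp (by fun_prop))
    (fun μ => Finset.sum_nonneg fun k _ => Finset.sum_nonneg fun x _ =>
      Finset.sum_nonneg fun y _ => abs_nonneg _) hexact hε
  refine ⟨δ, hδ, fun μ h0 h1 h2 h3 h4 => h μ ⟨fun k _ s _ => ⟨h0 k s, ?_⟩, h1, h2, h3⟩ h4⟩
  rw [← h1]
  exact (Finset.single_le_sum (fun s _ => h0 k s) (Finset.mem_univ s)).trans
    (Finset.single_le_sum (f := fun k => ∑ s, μ k s)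
      (fun k _ => Finset.sum_nonneg fun s _ => h0 k s) (Finset.mem_univ k))

end

/-! ### Converse for block mechanisms. -/

section

variable {X Y Z : Type*} [Fintype X] [Fintype Y] [Fintype Z]

/-- Law of the letter sequences under an `n`-letter mechanism. -/
def blockLaw {n : ℕ} (P : X × Y → ℝ) (W : (Fin n → X) → (Fin n → Y) → (Fin n → Z) → ℝ)
    (a : Fin n → X × Y × Z) : ℝ :=
  iidSource P n (fun i => (a i).1, fun i => (a i).2.1) *
    W (fun i => (a i).1) (fun i => (a i).2.1) (fun i => (a i).2.2)

omit [Fintype X] [Fintype Y] in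
lemma blockLaw_nonneg {n : ℕ} {P : X × Y → ℝ} (hP : ∀ p, 0 ≤ P p)
    {W : (Fin n → X) → (Fin n → Y) → (Fin n → Z) → ℝ} (hW : IsMechanism W)
    (a : Fin n → X × Y × Z) : 0 ≤ blockLaw P W a :=
  mul_nonneg (Finset.prod_nonneg fun _ _ => hP _) (hW.nonneg _ _ _)

lemma sum_blockLaw_mul {n : ℕ} (P : X × Y → ℝ)
    (W : (Fin n → X) → (Fin n → Y) → (Fin n → Z) → ℝ)
    (c : (Fin n → X) → (Fin n → Z) → ℝ) :
    ∑ a, blockLaw P W a * c (fun i => (a i).1) (fun i => (a i).2.2) =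
      expectedCost (iidSource P n) W c :=
  (sum_sum_sum_pi (fun x y z => iidSource P n (x, y) * W x y z * c x z)).symm

lemma sum_blockLaw_mul_source {n : ℕ} (P : X × Y → ℝ)
    {W : (Fin n → X) → (Fin n → Y) → (Fin n → Z) → ℝ} (hW : IsMechanism W)
    (c : (Fin n → X × Y) → ℝ) :
    ∑ a, blockLaw P W a * c (fun i => ((a i).1, (a i).2.1)) =
      ∑ p : Fin n → X × Y, (∏ i, P (p i)) * c p := by
  have h := sum_sum_sum_pi (fun (x : Fin n → X) (y : Fin n → Y) (z : Fin n → Z) =>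
    iidSource P n (x, y) * W x y z * c fun i => (x i, y i))
  refine h.symm.trans ?_
  simp only [← Finset.sum_mul, ← Finset.mul_sum, hW.sum_eq_one, mul_one]
  exact sum_sum_pi (fun (x : Fin n → X) (y : Fin n → Y) =>
    iidSource P n (x, y) * c fun i => (x i, y i))

lemma sum_blockLaw {n : ℕ} {P : X × Y → ℝ} (hP : P ∈ stdSimplex ℝ (X × Y))
    {W : (Fin n → X) → (Fin n → Y) → (Fin n → Z) → ℝ} (hW : IsMechanism W) :
    ∑ a, blockLaw P W a = 1 := by
  have h := sum_blockLaw_mul_source P hW fun _ => 1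
  simp only [mul_one] at h
  rw [h, sum_iid_eq_one hP.2]

/-- Mean absolute deviation of the letter frequencies of the source, on any sub-event. -/
lemma abs_sum_frequency_le {n : ℕ} (hn : 1 ≤ n) {P : X × Y → ℝ} (hP : P ∈ stdSimplex ℝ (X × Y))
    {W : (Fin n → X) → (Fin n → Y) → (Fin n → Z) → ℝ} (hW : IsMechanism W)
    {m : (Fin n → X × Y × Z) → ℝ} (hm0 : ∀ a, 0 ≤ m a) (hm : ∀ a, m a ≤ blockLaw P W a)
    {h : X × Y → ℝ} (h0 : ∑ p, P p * h p = 0) (h1 : ∀ p, |h p| ≤ 1) :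
    |(∑ a, m a * ∑ i, h ((a i).1, (a i).2.1)) / n| ≤ 1 / √n := by
  have hn' : (0 : ℝ) < n := by exact_mod_cast hn
  have hs : (0 : ℝ) < √n := Real.sqrt_pos.2 hn'
  have hss : √(n : ℝ) ^ 2 = n := Real.sq_sqrt hn'.le
  have hV : ∑ p, P p * h p ^ 2 ≤ 1 := by
    rw [← hP.2]
    refine Finset.sum_le_sum fun p _ => mul_le_of_le_one_right (hP.1 p) ?_
    rw [← sq_abs]
    exact pow_le_one₀ (abs_nonneg _) (h1 p)
  have hsq : ∑ a, blockLaw P W a * (∑ i, h ((a i).1, (a i).2.1)) ^ 2 ≤ n := by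
    rw [sum_blockLaw_mul_source P hW fun p => (∑ i, h (p i)) ^ 2, sum_iid_sq hP.2 h h0]
    exact mul_le_of_le_one_right hn'.le hV
  -- AM-GM balanced at the standard deviation scale `√n`: it bounds the first moment by the second,
  -- and then `m` may be replaced by the full block law, whose source part is i.i.d.
  have hpt : ∀ u : ℝ, |u| ≤ (u ^ 2 / √n + √n) / 2 := by
    intro u
    rw [le_div_iff₀ two_pos, div_add' _ _ _ hs.ne', le_div_iff₀ hs, ← sq_abs u]
    nlinarith [sq_nonneg (|u| - √n)]
  rw [abs_div, abs_of_pos hn', div_le_iff₀ hn']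
  calc |∑ a, m a * ∑ i, h ((a i).1, (a i).2.1)|
      ≤ ∑ a, blockLaw P W a * (((∑ i, h ((a i).1, (a i).2.1)) ^ 2 / √n + √n) / 2) := by
        refine (Finset.abs_sum_le_sum_abs _ _).trans (Finset.sum_le_sum fun a _ => ?_)
        rw [abs_mul, abs_of_nonneg (hm0 a)]
        exact mul_le_mul (hm a) (hpt _) (abs_nonneg _) (blockLaw_nonneg hP.1 hW a)
    _ = ((∑ a, blockLaw P W a * (∑ i, h ((a i).1, (a i).2.1)) ^ 2) / √n + √n) / 2 := by
        simp only [mul_div_assoc', ← Finset.sum_div, mul_add, Finset.sum_add_distrib,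
          ← Finset.sum_mul, sum_blockLaw hP hW, one_mul]
    _ ≤ (n / √n + √n) / 2 := by gcongr
    _ = 1 / √n * n := by
        have : (n : ℝ) / √n = √n := Real.div_sqrt
        rw [one_div_mul_eq_div, this]
        ring

/-- The letter law of an `n`-letter mechanism, split according to the cost level of the block. -/
lemma exists_level_laws {b : ℝ} (hb : 1 < b) {P : X × Y → ℝ} (hP : P ∈ stdSimplex ℝ (X × Y))
    {Dmin Dmax : ℝ} {d : X → Z → ℝ} (hd : ∀ x z, d x z ∈ Icc Dmin Dmax) {f : ℝ → ℝ} {t η : ℝ}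
    {K : ℕ} (hK : 0 < K) (T : Fin K → ℝ) (κ : ℝ → Fin K)
    (hκ : ∀ D ∈ Icc Dmin Dmax, T (κ D) - η ≤ f D ∧ f D < T (κ D)) {n : ℕ} (hn : 1 ≤ n)
    {W : (Fin n → X) → (Fin n → Y) → (Fin n → Z) → ℝ} (hW : IsMechanism W)
    (hcost : expectedCost (iidSource P n) W (fun x z => f (blockDistortion d n x z)) ≤ t) :
    ∃ μ : Fin K → X × Y × Z → ℝ, (∀ k s, 0 ≤ μ k s) ∧ ∑ k, ∑ s, μ k s = 1 ∧
      (∀ k, ∑ s, μ k s * d s.1 s.2.2 ≤ lowerInv Dmin Dmax f (T k) * ∑ s, μ k s) ∧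
      ∑ k, (∑ s, μ k s) * T k ≤ t + η ∧
      sourceDeviation P μ ≤ K * (Fintype.card X * (Fintype.card Y * (1 / √n))) ∧
      (privEntropy P - ∑ k, condEntropy (fun y z => ∑ x, μ k (x, y, z))) / Real.log b -
        Real.log K / Real.log b / n ≤ 1 / (n : ℝ) * leakage b (iidSource P n) W := by
  classical
  have hn' : (0 : ℝ) < n := by exact_mod_cast hn
  set M := blockLaw P W with hM
  have hM0 : ∀ a, 0 ≤ M a := blockLaw_nonneg hP.1 hW
  set dist : (Fin n → X × Y × Z) → ℝ := fun a =>
    blockDistortion d n (fun i => (a i).1) (fun i => (a i).2.2) with hdist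
  have hdm : ∀ a, dist a ∈ Icc Dmin Dmax := fun a => blockDistortion_mem_Icc hd hn _ _
  -- The block law restricted to level `k`, left unnormalized so that levels of small probability
  -- need no separate treatment.
  set m : Fin K → (Fin n → X × Y × Z) → ℝ := fun k a => if κ (dist a) = k then M a else 0 with hm
  have hm0 : ∀ k a, 0 ≤ m k a := fun k a => by
    simp only [hm]
    split_ifs
    exacts [hM0 a, le_rfl]
  have hmM : ∀ k a, m k a ≤ M a := fun k a => by
    simp only [hm]
    split_ifs
    exacts [le_rfl, hM0 a]
  have hmT : ∀ (g : Fin K → ℝ) a, ∑ k, m k a * g k = M a * g (κ (dist a)) := fun g a => by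
    simp [hm]
  have hms : ∀ a, ∑ k, m k a = M a := fun a => by simpa using hmT (fun _ => 1) a
  refine ⟨fun k => letterLaw (m k), fun k s => letterLaw_nonneg (hm0 k) s, ?_, fun k => ?_, ?_,
    ?_, ?_⟩
  · simp only [sum_letterLaw hn]
    rw [Finset.sum_comm]
    simp only [hms]
    exact sum_blockLaw hP hW
  · rw [sum_letterLaw hn, sum_letterLaw_mul (m k) fun s => d s.1 s.2.2, Finset.sum_div,
      Finset.mul_sum]
    refine Finset.sum_le_sum fun a _ => ?_
    rw [mul_div_assoc, mul_comm (lowerInv _ _ _ _)]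
    by_cases h : κ (dist a) = k
    -- On level `k` the block distortion has cost strictly below `T k`, so it belongs to the set
    -- whose supremum is `lowerInv` at `T k`.
    · refine mul_le_mul_of_nonneg_left ?_ (hm0 k a)
      refine le_csSup ⟨Dmax, fun D hD => hD.1.2⟩ ⟨hdm a, ?_⟩
      rw [← h]
      exact (hκ _ (hdm a)).2
    · simp [hm, h]
  · simp only [sum_letterLaw hn, Finset.sum_mul]
    rw [Finset.sum_comm]
    simp only [hmT]
    rw [← sum_blockLaw_mul P W (fun x z => f (blockDistortion d n x z))] at hcost
    have h1 : ∑ a, M a * T (κ (dist a)) ≤ ∑ a, M a * (f (dist a) + η) :=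
      Finset.sum_le_sum fun a _ => mul_le_mul_of_nonneg_left
        (by linarith [(hκ _ (hdm a)).1]) (hM0 a)
    refine h1.trans ?_
    simp only [mul_add, Finset.sum_add_distrib, ← Finset.sum_mul]
    rw [hM, sum_blockLaw hP hW, one_mul]
    exact add_le_add_left hcost _
  · have hdev : ∀ k x y, |(∑ z, letterLaw (m k) (x, y, z)) -
        (∑ s, letterLaw (m k) s) * P (x, y)| ≤ 1 / √n := by
      intro k x y
      -- The centred indicator of the letter `(x, y)`.
      set h : X × Y → ℝ := fun p => (if p = (x, y) then 1 else 0) - P (x, y) with hh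
      have hPxy : P (x, y) ≤ 1 := by
        rw [← hP.2]
        exact Finset.single_le_sum (fun p _ => hP.1 p) (Finset.mem_univ _)
      have e : (∑ z, letterLaw (m k) (x, y, z)) - (∑ s, letterLaw (m k) s) * P (x, y) =
          (∑ a, m k a * ∑ i, h ((a i).1, (a i).2.1)) / n := by
        rw [← sum_letterLaw_mul (m k) fun s => h (s.1, s.2.1)]
        simp only [hh, mul_sub, Finset.sum_sub_distrib, ← Finset.sum_mul]
        congr 1
        rw [Fintype.sum_prod_type, Finset.sum_eq_single x, Fintype.sum_prod_type,
          Finset.sum_eq_single y]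
        · simp
        · intro y' _ hy
          simp [hy]
        · simp
        · intro x' _ hx
          simp [hx]
        · simp
      rw [e]
      refine abs_sum_frequency_le hn hP hW (hm0 k) (hmM k) ?_ fun p => ?_
      · simp only [hh, mul_sub, Finset.sum_sub_distrib, ← Finset.sum_mul, hP.2]
        simp
      · have := hP.1 (x, y)
        simp only [hh]
        rw [abs_le]
        split_ifs <;> constructor <;> linarith
    refine (Finset.sum_le_sum fun k _ => Finset.sum_le_sum fun x _ => Finset.sum_le_sum
      fun y _ => hdev k x y).trans_eq ?_
    simp
  · set q : Fin K → (Fin n → Y) → (Fin n → Z) → ℝ := fun k y z =>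
      ∑ x : Fin n → X, m k (fun i => (x i, y i, z i)) with hq
    have hq0 : ∀ k y z, 0 ≤ q k y z := fun k y z => Finset.sum_nonneg fun x _ => hm0 k _
    have hqsum : (fun y z => ∑ k, q k y z) = outLaw (iidSource P n) W := by
      funext y z
      simp only [hq, outLaw]
      rw [Finset.sum_comm]
      exact Finset.sum_congr rfl fun x _ => hms _
    have hqF : ∀ k (F : (Fin n → Y) → (Fin n → Z) → ℝ), ∑ y, ∑ z, q k y z * F y z =
        ∑ a, m k a * F (fun i => (a i).2.1) (fun i => (a i).2.2) := by
      intro k F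
      have h := sum_sum_sum_pi (fun (x : Fin n → X) (y : Fin n → Y) (z : Fin n → Z) =>
        m k (fun i => (x i, y i, z i)) * F y z)
      refine Eq.trans ?_ h
      refine Eq.trans (Finset.sum_congr rfl fun y _ => ?_) Finset.sum_comm
      refine Eq.trans (Finset.sum_congr rfl fun z _ => ?_) Finset.sum_comm
      exact Finset.sum_mul _ _ _
    have htot : ∑ k, ∑ y, ∑ z, q k y z = 1 := by
      have : ∀ k, ∑ y, ∑ z, q k y z = ∑ a, m k a := fun k => by simpa using hqF k fun _ _ => 1
      simp only [this]
      rw [Finset.sum_comm]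
      simp only [hms]
      exact sum_blockLaw hP hW
    -- The sum of the letter marginals is `n` times their average; homogeneity later extracts the
    -- factor `n`.
    have key := condEntropy_sum_le hK q hq0
      (fun k y z => n * ∑ x, letterLaw (m k) (x, y, z))
      (fun k y z => mul_nonneg hn'.le (Finset.sum_nonneg fun x _ => letterLaw_nonneg (hm0 k) _))
      (by
        intro k g
        rw [hqF k fun y z => ∑ i, g (y i) (z i)]
        have h := sum_letterLaw_mul (m k) fun s => g s.2.1 s.2.2
        rw [eq_div_iff hn'.ne'] at h
        have h' : ∑ s, letterLaw (m k) s * g s.2.1 s.2.2 =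
            ∑ y, ∑ z, ∑ x, letterLaw (m k) (x, y, z) * g y z := by
          rw [Fintype.sum_prod_type, Finset.sum_comm, Fintype.sum_prod_type]
        rw [← h, h', Finset.sum_mul]
        refine Finset.sum_congr rfl fun y _ => ?_
        rw [Finset.sum_mul]
        refine Finset.sum_congr rfl fun z _ => ?_
        rw [← Finset.sum_mul]
        ring)
    rw [hqsum, htot, one_mul] at key
    simp only [condEntropy_smul, ← Finset.mul_sum] at key
    rw [leakage_eq b (iidSource_mem hP n).1 hW, privEntropy_iidSource hP]
    have hlb := Real.log_pos hb
    rw [div_div, mul_comm (Real.log b) (n : ℝ), ← div_div, ← sub_div, mul_div_assoc']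
    refine div_le_div_of_nonneg_right ?_ hlb.le
    rw [one_div_mul_eq_div, le_div_iff₀ hn', sub_mul, div_mul_cancel₀ _ hn'.ne']
    linarith

lemma memorylessLeakages_subset (b : ℝ) (P : X × Y → ℝ) (d : X → Z → ℝ) (f : ℝ → ℝ) (t : ℝ)
    (n : ℕ) : memorylessLeakages b P d f t n ⊆ generalLeakages b P d f t n := by
  rintro _ ⟨W, hW, hc, rfl⟩
  exact ⟨_, isMechanism_memoryless hW n, hc, rfl⟩

/-- A rising chord would continue with at least its slope and pass `M`; the point `z` is where its
extension reaches `M + 1`. -/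
lemma antitoneOn_of_convexOn_of_bounded {a M : ℝ} {s : ℝ → ℝ} (hs : ConvexOn ℝ (Ioi a) s)
    (hM : ∀ x ∈ Ioi a, s x ≤ M) : AntitoneOn s (Ioi a) := by
  intro x hx y hy hxy
  by_contra! h
  have hlt : x < y := lt_of_le_of_ne hxy fun e => by simp [e] at h
  set c := (s y - s x) / (y - x) with hc
  have hc0 : 0 < c := div_pos (sub_pos.2 h) (sub_pos.2 hlt)
  set z := y + (M - s y + 1) / c with hz
  have hpos : 0 < (M - s y + 1) / c := div_pos (by linarith [hM y hy]) hc0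
  have hyz : y < z := by linarith
  have hzm : z ∈ Ioi a := lt_trans hy hyz
  have h1 := hs.slope_mono_adjacent hx hzm hlt hyz
  rw [← hc, le_div_iff₀ (sub_pos.2 hyz)] at h1
  have h2 : c * (z - y) = M - s y + 1 := by
    rw [hz, add_sub_cancel_left]
    field_simp
  linarith [hM z hzm]

lemma singleLetterLeakage_anti (b : ℝ) {P : X × Y → ℝ} (hP : P ∈ stdSimplex ℝ (X × Y))
    {Dmin : ℝ} {d : X → Z → ℝ} (hfeas : ∀ x, (∃ y, 0 < P (x, y)) → ∃ z, d x z = Dmin) {D D' : ℝ}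
    (hD : Dmin ≤ D) (hDD : D ≤ D') :
    singleLetterLeakage b P d D' ≤ singleLetterLeakage b P d D := by
  obtain ⟨W, hW, hc, he⟩ := exists_leakage_eq_sInf b hP.1 (exists_mechanism_of_mem_Icc hP hfeas hD)
  exact (sInf_mechanismLeakages_le b hP.1 hW (hc.trans hDD)).trans_eq he

/-- Converse: every convex minorant of the single-letter leakage at the lower inverse of the cost
function asymptotically bounds the leakage of general mechanisms from below. -/
lemma eventually_le_generalLeakage {b : ℝ} (hb : 1 < b) {P : X × Y → ℝ}
    (hP : P ∈ stdSimplex ℝ (X × Y)) {Dmin Dmax : ℝ} (hDD : Dmin ≤ Dmax) {d : X → Z → ℝ}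
    (hd : ∀ x z, d x z ∈ Icc Dmin Dmax)
    (hfeas : ∀ x, (∃ y, 0 < P (x, y)) → ∃ z, d x z = Dmin) {f : ℝ → ℝ}
    (hf_mono : MonotoneOn f (Icc Dmin Dmax)) {t : ℝ} (ht : f Dmin < t) {s : ℝ → ℝ}
    (hs : ConvexOn ℝ (Ioi (f Dmin)) s)
    (hsr : ∀ x ∈ Ioi (f Dmin), s x ≤ singleLetterLeakage b P d (lowerInv Dmin Dmax f x))
    {η ε : ℝ} (hη : 0 < η) (hε : 0 < ε) :
    ∀ᶠ n : ℕ in atTop, s (t + η) - ε ≤ generalLeakage b P d f t n := by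
  have hanti : AntitoneOn s (Ioi (f Dmin)) := antitoneOn_of_convexOn_of_bounded hs fun x hx =>
    (hsr x hx).trans (singleLetterLeakage_anti b hP hfeas le_rfl (lowerInv_mem_Icc hDD hx).1)
  -- Levels of width `η` covering `[f Dmin, f Dmax]`. `T k` is the upper end of level `k`, whence
  -- the shift `k + 1`: costs lie strictly below `T k`, and `T k > f Dmin`.
  set K := ⌊(f Dmax - f Dmin) / η⌋₊ + 1 with hK
  set T : Fin K → ℝ := fun k => f Dmin + (k + 1) * η with hT
  have hTmem : ∀ k, T k ∈ Ioi (f Dmin) := fun k => by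
    have : 0 < ((k : ℝ) + 1) * η := by positivity
    simpa [hT] using this
  obtain ⟨κ, hκ⟩ : ∃ κ : ℝ → Fin K, ∀ D ∈ Icc Dmin Dmax,
      T (κ D) - η ≤ f D ∧ f D < T (κ D) := by
    have hex : ∀ D : ℝ, ∃ k : Fin K, D ∈ Icc Dmin Dmax → T k - η ≤ f D ∧ f D < T k := by
      intro D
      by_cases hD : D ∈ Icc Dmin Dmax
      · have h1 := hf_mono ⟨le_rfl, hDD⟩ hD hD.1
        have h2 := hf_mono hD ⟨hDD, le_rfl⟩ hD.2
        have h0 : 0 ≤ (f D - f Dmin) / η := div_nonneg (by linarith) hη.le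
        refine ⟨⟨⌊(f D - f Dmin) / η⌋₊, Nat.lt_succ_of_le (Nat.floor_le_floor ?_)⟩, fun _ => ?_⟩
        · gcongr
        · have h3 := Nat.floor_le h0
          have h4 := Nat.lt_floor_add_one ((f D - f Dmin) / η)
          rw [le_div_iff₀ hη] at h3
          rw [div_lt_iff₀ hη] at h4
          simp only [hT]
          constructor <;> linarith
      · exact ⟨⟨0, Nat.succ_pos _⟩, fun h => absurd h hD⟩
    choose κ hκ using hex
    exact ⟨κ, hκ⟩
  obtain ⟨W₀, hW₀, -⟩ := exists_expectedCost_eq_min hP hfeas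
  obtain ⟨δ, hδ, hbound⟩ := exists_deviation_bound b hP d ⟨W₀, hW₀⟩
    (fun k => lowerInv Dmin Dmax f (T k)) T (τ := t + η) (v := s (t + η)) (by
      intro p hp0 hp1 hpT
      -- Jensen for `s`, then `s` nonincreasing, since the mean of the `T k` is at most `t + η`.
      have h1 : s (∑ k, p k * T k) ≤ ∑ k, p k * s (T k) := by
        simpa using hs.map_sum_le (fun k _ => hp0 k) hp1 fun k _ => hTmem k
      have h2 : ∑ k, p k * T k ∈ Ioi (f Dmin) := by
        simpa using (convex_Ioi (f Dmin)).sum_mem (fun k _ => hp0 k) hp1 fun k _ => hTmem k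
      have h3 := hanti h2 (show t + η ∈ Ioi (f Dmin) from lt_trans ht (by linarith)) hpT
      exact h3.trans (h1.trans (Finset.sum_le_sum fun k _ =>
        mul_le_mul_of_nonneg_left (hsr _ (hTmem k)) (hp0 k)))) (half_pos hε)
  have hlim1 : Tendsto (fun n : ℕ => (K : ℝ) * (Fintype.card X * (Fintype.card Y * (1 / √n))))
      atTop (𝓝 0) := by
    have h : Tendsto (fun n : ℕ => 1 / √(n : ℝ)) atTop (𝓝 0) := by
      simp only [one_div]
      exact tendsto_inv_atTop_zero.comp (Real.tendsto_sqrt_atTop.comp tendsto_natCast_atTop_atTop)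
    simpa using ((h.const_mul (Fintype.card Y : ℝ)).const_mul (Fintype.card X : ℝ)).const_mul
      (K : ℝ)
  have hlim2 : Tendsto (fun n : ℕ => Real.log K / Real.log b / n) atTop (𝓝 0) :=
    tendsto_const_div_atTop_nhds_zero_nat _
  filter_upwards [hlim1.eventually_lt_const hδ, hlim2.eventually_lt_const (half_pos hε),
    eventually_ge_atTop 1] with n h1 h2 hn
  refine le_csInf ((nonempty_memorylessLeakages b hP hd hfeas ht hn).mono
    (memorylessLeakages_subset b P d f t n)) ?_
  rintro _ ⟨W, hW, hcost, rfl⟩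
  obtain ⟨μ, hμ0, hμ1, hμd, hμT, hμdev, hμL⟩ :=
    exists_level_laws hb hP hd (Nat.succ_pos _) T κ hκ hn hW hcost
  have h3 := hbound μ hμ0 hμ1 hμd hμT (hμdev.trans_lt h1)
  linarith

end

/-! ### Convex envelopes, convex costs and the limit. -/

section

variable {X Y Z : Type*} [Fintype X] [Fintype Y] [Fintype Z]

lemma isCompact_generalLeakages (b : ℝ) {P : X × Y → ℝ} (hP : P ∈ stdSimplex ℝ (X × Y))
    (d : X → Z → ℝ) (f : ℝ → ℝ) (t : ℝ) (n : ℕ) : IsCompact (generalLeakages b P d f t n) := by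
  have : generalLeakages b P d f t n = (fun r => 1 / (n : ℝ) * r) ''
      mechanismLeakages b (iidSource P n)
        (fun (x : Fin n → X) (z : Fin n → Z) => f (blockDistortion d n x z)) t := by
    ext r
    constructor
    · rintro ⟨W, h1, h2, rfl⟩
      exact ⟨_, ⟨W, h1, h2, rfl⟩, rfl⟩
    · rintro ⟨_, ⟨W, h1, h2, rfl⟩, rfl⟩
      exact ⟨W, h1, h2, rfl⟩
  rw [this]
  exact (isCompact_mechanismLeakages b (iidSource_mem hP n).1 _ t).image (by fun_prop)

lemma generalLeakage_nonneg {b : ℝ} (hb : 1 < b) {P : X × Y → ℝ} (hP : P ∈ stdSimplex ℝ (X × Y))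
    (d : X → Z → ℝ) (f : ℝ → ℝ) (t : ℝ) (n : ℕ) : 0 ≤ generalLeakage b P d f t n := by
  refine Real.sInf_nonneg ?_
  rintro _ ⟨W, hW, -, rfl⟩
  exact mul_nonneg (by positivity) (leakage_nonneg hb (iidSource_mem hP n) hW)

/-- Mixtures of `n`-letter mechanisms are again mechanisms, though mixtures of memoryless ones need
not be memoryless. This is the source of the convex envelope. -/
lemma generalLeakage_combo_le {b : ℝ} (hb : 1 < b) {P : X × Y → ℝ}
    (hP : P ∈ stdSimplex ℝ (X × Y)) {d : X → Z → ℝ} {f : ℝ → ℝ} {t₁ t₂ : ℝ} {n : ℕ}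
    (h₁ : (generalLeakages b P d f t₁ n).Nonempty) (h₂ : (generalLeakages b P d f t₂ n).Nonempty)
    {u v : ℝ} (hu : 0 ≤ u) (hv : 0 ≤ v) (huv : u + v = 1) :
    generalLeakage b P d f (u * t₁ + v * t₂) n ≤
      u * generalLeakage b P d f t₁ n + v * generalLeakage b P d f t₂ n := by
  obtain ⟨W₁, m₁, c₁, e₁⟩ := (isCompact_generalLeakages b hP d f t₁ n).sInf_mem h₁
  obtain ⟨W₂, m₂, c₂, e₂⟩ := (isCompact_generalLeakages b hP d f t₂ n).sInf_mem h₂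
  have h := leakage_combo_le hb (iidSource_mem hP n).1 m₁ m₂ hu hv huv
  unfold generalLeakage
  rw [e₁, e₂]
  refine (csInf_le (isCompact_generalLeakages b hP d f _ n).bddBelow
    ⟨_, m₁.combo m₂ hu hv huv, ?_, rfl⟩).trans
    ((mul_le_mul_of_nonneg_left h (by positivity)).trans_eq (by ring))
  rw [expectedCost_combo]
  exact add_le_add (mul_le_mul_of_nonneg_left c₁ hu) (mul_le_mul_of_nonneg_left c₂ hv)

lemma lowerInv_le_upperInv {Dmin Dmax : ℝ} (h : Dmin ≤ Dmax) {f : ℝ → ℝ} {t : ℝ}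
    (ht : f Dmin < t) : lowerInv Dmin Dmax f t ≤ upperInv Dmin Dmax f t :=
  csSup_le_csSup ⟨Dmax, fun _ hx => hx.1.2⟩ ⟨Dmin, ⟨le_rfl, h⟩, ht⟩ fun _ hx => ⟨hx.1, hx.2.le⟩

lemma upperInv_le_lowerInv_of_lt {Dmin Dmax : ℝ} (h : Dmin ≤ Dmax) {f : ℝ → ℝ} {t t' : ℝ}
    (ht : f Dmin < t) (htt : t < t') : upperInv Dmin Dmax f t ≤ lowerInv Dmin Dmax f t' :=
  csSup_le_csSup ⟨Dmax, fun _ hx => hx.1.2⟩ ⟨Dmin, ⟨le_rfl, h⟩, ht.le⟩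
    fun _ hx => ⟨hx.1, hx.2.trans_lt htt⟩

/-- Both functions have the same convex minorants: the upper inverse at `x` is at most the lower
inverse at any `y > x`, and a convex function on an open interval is continuous, so `y` may tend to
`x`. -/
lemma lowerConvexEnvelope_lowerInv_eq (b : ℝ) {P : X × Y → ℝ} (hP : P ∈ stdSimplex ℝ (X × Y))
    {Dmin Dmax : ℝ} (hDD : Dmin ≤ Dmax) {d : X → Z → ℝ}
    (hfeas : ∀ x, (∃ y, 0 < P (x, y)) → ∃ z, d x z = Dmin) (f : ℝ → ℝ) (t : ℝ) :
    lowerConvexEnvelope (Ioi (f Dmin))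
        (fun s => singleLetterLeakage b P d (lowerInv Dmin Dmax f s)) t =
      lowerConvexEnvelope (Ioi (f Dmin))
        (fun s => singleLetterLeakage b P d (upperInv Dmin Dmax f s)) t := by
  unfold lowerConvexEnvelope
  congr 1
  ext v
  refine exists_congr fun s => and_congr_right fun hs => and_congr_left fun _ => ?_
  constructor
  · intro h x hx
    have hcont : ContinuousWithinAt s (Ioi x) x :=
      ((hs.continuousOn isOpen_Ioi).continuousAt (Ioi_mem_nhds hx)).continuousWithinAt
    refine le_of_tendsto hcont (eventually_mem_nhdsWithin.mono fun y hy => ?_)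
    refine (h y (mem_Ioi.2 (lt_trans hx hy))).trans (singleLetterLeakage_anti b hP hfeas ?_
      (upperInv_le_lowerInv_of_lt hDD hx hy))
    exact (lowerInv_mem_Icc hDD hx).1.trans (lowerInv_le_upperInv hDD hx)
  · intro h x hx
    exact (h x hx).trans (singleLetterLeakage_anti b hP hfeas (lowerInv_mem_Icc hDD hx).1
      (lowerInv_le_upperInv hDD hx))

lemma lowerInv_eq_upperInv_of_convexOn {Dmin Dmax : ℝ} (hDD : Dmin ≤ Dmax) {f : ℝ → ℝ}
    (hf : ConvexOn ℝ (Icc Dmin Dmax) f) {t : ℝ} (ht : f Dmin < t) :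
    lowerInv Dmin Dmax f t = upperInv Dmin Dmax f t := by
  refine le_antisymm (lowerInv_le_upperInv hDD ht)
    (csSup_le ⟨Dmin, ⟨le_rfl, hDD⟩, ht.le⟩ fun D ⟨hD, hfD⟩ => ?_)
  have hl := (lowerInv_mem_Icc hDD ht).1
  set l := lowerInv Dmin Dmax f t with hldef
  by_contra! hlt
  have hpos : 0 < D - Dmin := by linarith
  -- With this weight the combination of `Dmin` and `D` is the midpoint of `l` and `D`. As `f Dmin <
  -- t` and `u > 0`, its cost is strictly below `t`, though it lies beyond the supremum `l`.
  set u := (D - l) / 2 / (D - Dmin) with hu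
  have hu0 : 0 < u := div_pos (by linarith) hpos
  have hu1 : u ≤ 1 := (div_le_one hpos).2 (by linarith)
  have hD' : u * Dmin + (1 - u) * D = (D + l) / 2 := by
    have : u * (D - Dmin) = (D - l) / 2 := div_mul_cancel₀ _ hpos.ne'
    linarith
  have h1 := hf.2 ⟨le_rfl, hDD⟩ hD hu0.le (sub_nonneg.2 hu1) (by ring)
  simp only [smul_eq_mul] at h1
  rw [hD'] at h1
  have h2 : f ((D + l) / 2) < t := by nlinarith
  have h3 : (D + l) / 2 ≤ l :=
    le_csSup ⟨Dmax, fun _ hx => hx.1.2⟩ ⟨⟨by linarith, by linarith [hD.2]⟩, h2⟩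
  linarith

lemma upperInv_combo_le {Dmin Dmax : ℝ} (hDD : Dmin ≤ Dmax) {f : ℝ → ℝ}
    (hf : ConvexOn ℝ (Icc Dmin Dmax) f) {t₁ t₂ : ℝ} (h₁ : f Dmin < t₁) (h₂ : f Dmin < t₂)
    {u v : ℝ} (hu : 0 ≤ u) (hv : 0 ≤ v) (huv : u + v = 1) :
    u * upperInv Dmin Dmax f t₁ + v * upperInv Dmin Dmax f t₂ ≤
      upperInv Dmin Dmax f (u * t₁ + v * t₂) := by
  refine le_of_forall_pos_le_add fun ε hε => ?_
  obtain ⟨D₁, ⟨m₁, c₁⟩, l₁⟩ := exists_lt_of_lt_csSup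
    (⟨Dmin, ⟨le_rfl, hDD⟩, h₁.le⟩ : {D | D ∈ Icc Dmin Dmax ∧ f D ≤ t₁}.Nonempty)
    (sub_lt_self (upperInv Dmin Dmax f t₁) hε)
  obtain ⟨D₂, ⟨m₂, c₂⟩, l₂⟩ := exists_lt_of_lt_csSup
    (⟨Dmin, ⟨le_rfl, hDD⟩, h₂.le⟩ : {D | D ∈ Icc Dmin Dmax ∧ f D ≤ t₂}.Nonempty)
    (sub_lt_self (upperInv Dmin Dmax f t₂) hε)
  have hmem : u * D₁ + v * D₂ ≤ upperInv Dmin Dmax f (u * t₁ + v * t₂) := by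
    refine le_csSup ⟨Dmax, fun _ hx => hx.1.2⟩ ⟨convex_Icc Dmin Dmax m₁ m₂ hu hv huv, ?_⟩
    exact (hf.2 m₁ m₂ hu hv huv).trans (add_le_add (mul_le_mul_of_nonneg_left c₁ hu)
      (mul_le_mul_of_nonneg_left c₂ hv))
  have e : ε = u * ε + v * ε := by rw [← add_mul, huv, one_mul]
  nlinarith [mul_le_mul_of_nonneg_left l₁.le hu, mul_le_mul_of_nonneg_left l₂.le hv]

/-- A convex nonincreasing function composed with a concave one; the concavity of the inverse is
`upperInv_combo_le`. -/
lemma convexOn_singleLetterLeakage_lowerInv {b : ℝ} (hb : 1 < b) {P : X × Y → ℝ}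
    (hP : P ∈ stdSimplex ℝ (X × Y)) {Dmin Dmax : ℝ} (hDD : Dmin ≤ Dmax) {d : X → Z → ℝ}
    (hfeas : ∀ x, (∃ y, 0 < P (x, y)) → ∃ z, d x z = Dmin) {f : ℝ → ℝ}
    (hf : ConvexOn ℝ (Icc Dmin Dmax) f) :
    ConvexOn ℝ (Ioi (f Dmin))
      fun s => singleLetterLeakage b P d (lowerInv Dmin Dmax f s) := by
  refine ⟨convex_Ioi _, fun x hx y hy u v hu hv huv => ?_⟩
  have hxy : u • x + v • y ∈ Ioi (f Dmin) := convex_Ioi _ hx hy hu hv huv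
  simp only [smul_eq_mul] at hxy ⊢
  have hx' := (lowerInv_mem_Icc hDD hx).1
  have hy' := (lowerInv_mem_Icc hDD hy).1
  have h1 := upperInv_combo_le hDD hf hx hy hu hv huv
  rw [← lowerInv_eq_upperInv_of_convexOn hDD hf hx, ← lowerInv_eq_upperInv_of_convexOn hDD hf hy,
    ← lowerInv_eq_upperInv_of_convexOn hDD hf hxy] at h1
  refine (singleLetterLeakage_anti b hP hfeas ?_ h1).trans
    (sInf_mechanismLeakages_combo_le hb hP.1 (exists_mechanism_of_mem_Icc hP hfeas hx')
      (exists_mechanism_of_mem_Icc hP hfeas hy') hu hv huv)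
  have : Dmin = u * Dmin + v * Dmin := by rw [← add_mul, huv, one_mul]
  refine this.le.trans ?_
  exact add_le_add (mul_le_mul_of_nonneg_left hx' hu) (mul_le_mul_of_nonneg_left hy' hv)

/-- The limit of the leakage of general mechanisms is the lower convex envelope of the single-letter
leakage at the lower inverse of the cost function. -/
lemma tendsto_generalLeakage {b : ℝ} (hb : 1 < b) {P : X × Y → ℝ}
    (hP : P ∈ stdSimplex ℝ (X × Y)) {Dmin Dmax : ℝ} (hDD : Dmin ≤ Dmax) {d : X → Z → ℝ}
    (hd : ∀ x z, d x z ∈ Icc Dmin Dmax)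
    (hfeas : ∀ x, (∃ y, 0 < P (x, y)) → ∃ z, d x z = Dmin) {f : ℝ → ℝ}
    (hf_nonneg : ∀ D ∈ Icc Dmin Dmax, 0 ≤ f D) (hf_mono : MonotoneOn f (Icc Dmin Dmax))
    {t : ℝ} (ht : f Dmin < t) :
    Tendsto (fun n : ℕ => generalLeakage b P d f t n) atTop
      (𝓝 (lowerConvexEnvelope (Ioi (f Dmin))
        (fun s => singleLetterLeakage b P d (lowerInv Dmin Dmax f s)) t)) := by
  set r : ℝ → ℝ := fun s => singleLetterLeakage b P d (lowerInv Dmin Dmax f s) with hr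
  -- The limsup is shown to be a convex minorant of `r`, hence one of the competitors in the
  -- envelope.
  set G : ℝ → ℝ := fun x => limsup (fun n : ℕ => generalLeakage b P d f x n) atTop with hG
  have hne : ∀ x ∈ Ioi (f Dmin), ∀ n : ℕ, 1 ≤ n → (generalLeakages b P d f x n).Nonempty :=
    fun x hx n hn => (nonempty_memorylessLeakages b hP hd hfeas hx hn).mono
      (memorylessLeakages_subset b P d f x n)
  have hup : ∀ x ∈ Ioi (f Dmin), ∀ ε > 0, ∀ᶠ n : ℕ in atTop,
      generalLeakage b P d f x n ≤ r x + ε := by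
    intro x hx ε hε
    filter_upwards [eventually_memorylessLeakage_le hb hP hDD hd hfeas hf_nonneg hf_mono hx hε,
      eventually_ge_atTop 1] with n hn hn1
    exact (csInf_le_csInf (isCompact_generalLeakages b hP d f x n).bddBelow
      (nonempty_memorylessLeakages b hP hd hfeas hx hn1)
      (memorylessLeakages_subset b P d f x n)).trans hn
  have hcob : ∀ x, IsCoboundedUnder (· ≤ ·) atTop fun n : ℕ => generalLeakage b P d f x n :=
    fun x => IsBoundedUnder.isCoboundedUnder_le
      ⟨0, eventually_map.2 (Eventually.of_forall fun n => generalLeakage_nonneg hb hP d f x n)⟩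
  have hbdd : ∀ x ∈ Ioi (f Dmin),
      IsBoundedUnder (· ≤ ·) atTop fun n : ℕ => generalLeakage b P d f x n :=
    fun x hx => ⟨r x + 1, eventually_map.2 (hup x hx 1 one_pos)⟩
  have hGlt : ∀ x ∈ Ioi (f Dmin), ∀ ε > 0, ∀ᶠ n : ℕ in atTop,
      generalLeakage b P d f x n < G x + ε := fun x hx ε hε =>
    eventually_lt_of_limsup_lt (lt_add_of_pos_right _ hε) (hbdd x hx)
  have hGr : ∀ x ∈ Ioi (f Dmin), G x ≤ r x := fun x hx =>
    le_of_forall_pos_le_add fun ε hε => limsup_le_of_le (hcob x) (hup x hx ε hε)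
  have hGconv : ConvexOn ℝ (Ioi (f Dmin)) G := by
    refine ⟨convex_Ioi _, fun x hx y hy u v hu hv huv => ?_⟩
    simp only [smul_eq_mul]
    refine le_of_forall_pos_le_add fun ε hε => limsup_le_of_le (hcob _) ?_
    filter_upwards [hGlt x hx ε hε, hGlt y hy ε hε, eventually_ge_atTop 1] with n h1 h2 hn
    refine (generalLeakage_combo_le hb hP (hne x hx n hn) (hne y hy n hn) hu hv huv).trans ?_
    have e : ε = u * ε + v * ε := by rw [← add_mul, huv, one_mul]
    nlinarith [mul_le_mul_of_nonneg_left h1.le hu, mul_le_mul_of_nonneg_left h2.le hv]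
  have hGmem : G t ∈ {v | ∃ s : ℝ → ℝ, ConvexOn ℝ (Ioi (f Dmin)) s ∧
      (∀ x ∈ Ioi (f Dmin), s x ≤ r x) ∧ v = s t} := ⟨G, hGconv, hGr, rfl⟩
  have hGle : G t ≤ lowerConvexEnvelope (Ioi (f Dmin)) r t :=
    le_csSup ⟨r t, fun v ⟨s, _, hs, hv⟩ => hv ▸ hs t ht⟩ hGmem
  refine tendsto_order.2 ⟨fun a ha => ?_, fun a ha => ?_⟩
  -- Some convex minorant exceeds `a` at `t`, and by continuity still at some `y > t`; the converse
  -- applies with `η = y - t`.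
  · obtain ⟨_, ⟨s, hs, hsr, rfl⟩, hst⟩ := exists_lt_of_lt_csSup ⟨_, hGmem⟩ ha
    have hcont : ContinuousWithinAt s (Ioi t) t :=
      ((hs.continuousOn isOpen_Ioi).continuousAt (Ioi_mem_nhds ht)).continuousWithinAt
    obtain ⟨y, hy, hty⟩ := ((hcont.eventually_const_lt hst).and eventually_mem_nhdsWithin).exists
    have hε : 0 < (s y - a) / 2 := by linarith
    filter_upwards [eventually_le_generalLeakage hb hP hDD hd hfeas hf_mono ht hs hsr
      (sub_pos.2 hty) hε] with n hn
    rw [add_sub_cancel] at hn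
    linarith
  · filter_upwards [hGlt t ht (a - G t) (by linarith)] with n hn
    linarith

end

end PrivacyLeakage

theorem theorem2 {X Y Z : Type*} [Fintype X] [Fintype Y] [Fintype Z]
    -- base of the logarithm
    (b : ℝ) (hb : 1 < b)
    -- law of the (public, private) pair
    (P : X × Y → ℝ) (hP : P ∈ stdSimplex ℝ (X × Y))
    -- distortion measure
    (Dmin Dmax : ℝ) (d : X → Z → ℝ) (hd : ∀ x z, d x z ∈ Icc Dmin Dmax)
    (hfeas : ∀ x, (∃ y, 0 < P (x, y)) → ∃ z, d x z = Dmin)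
    -- cost function
    (f : ℝ → ℝ) (hf_nonneg : ∀ D ∈ Icc Dmin Dmax, 0 ≤ f D)
    (hf_mono : MonotoneOn f (Icc Dmin Dmax))
    (hf_left : ∀ D ∈ Icc Dmin Dmax, ContinuousWithinAt f (Icc Dmin D) D)
    -- cost threshold
    (t : ℝ) (ht : f Dmin < t) :
    -- all the minima involved are attained
    (∀ D ∈ Icc Dmin Dmax,
      IsLeast (singleLetterLeakages b P d D) (singleLetterLeakage b P d D)) ∧
    (∀ n : ℕ, 1 ≤ n →
      IsLeast (generalLeakages b P d f t n) (generalLeakage b P d f t n) ∧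
      IsLeast (memorylessLeakages b P d f t n) (memorylessLeakage b P d f t n)) ∧
    -- the limit for general mechanisms, with either choice of the inverse of `f`
    Tendsto (fun n : ℕ => generalLeakage b P d f t n) atTop
      (𝓝 (lowerConvexEnvelope (Ioi (f Dmin))
        (fun s => singleLetterLeakage b P d (lowerInv Dmin Dmax f s)) t)) ∧
    Tendsto (fun n : ℕ => generalLeakage b P d f t n) atTop
      (𝓝 (lowerConvexEnvelope (Ioi (f Dmin))
        (fun s => singleLetterLeakage b P d (upperInv Dmin Dmax f s)) t)) ∧
    -- convex cost functions
    (ConvexOn ℝ (Icc Dmin Dmax) f →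
      lowerInv Dmin Dmax f t = upperInv Dmin Dmax f t ∧
      Tendsto (fun n : ℕ => generalLeakage b P d f t n) atTop
        (𝓝 (singleLetterLeakage b P d (lowerInv Dmin Dmax f t))) ∧
      Tendsto (fun n : ℕ => memorylessLeakage b P d f t n) atTop
        (𝓝 (singleLetterLeakage b P d (lowerInv Dmin Dmax f t)))) := by
  obtain ⟨g, hg⟩ := exists_minimal_release hP hfeas
  have hDD : Dmin ≤ Dmax := by
    obtain ⟨p, -⟩ : ∃ p, P p ≠ 0 := by
      by_contra! h
      simpa [h] using hP.2
    exact (hd p.1 (g p.1)).1.trans (hd p.1 (g p.1)).2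
  have hlim := tendsto_generalLeakage hb hP hDD hd hfeas hf_nonneg hf_mono ht
  refine ⟨fun D hD => ?_, fun n hn => ?_, hlim, ?_, fun hconv => ?_⟩
  · obtain ⟨W, hW, hc⟩ := exists_mechanism_of_mem_Icc hP hfeas hD.1
    exact (isCompact_mechanismLeakages b hP.1 d D).isLeast_sInf ⟨_, W, hW, hc, rfl⟩
  · have hne := nonempty_memorylessLeakages b hP hd hfeas ht hn
    exact ⟨(isCompact_generalLeakages b hP d f t n).isLeast_sInf
      (hne.mono (memorylessLeakages_subset b P d f t n)),
      (isCompact_memorylessLeakages b hP d f t n).isLeast_sInf hne⟩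
  · rwa [← lowerConvexEnvelope_lowerInv_eq b hP hDD hfeas]
  · have henv : lowerConvexEnvelope (Ioi (f Dmin))
        (fun s => singleLetterLeakage b P d (lowerInv Dmin Dmax f s)) t =
        singleLetterLeakage b P d (lowerInv Dmin Dmax f t) :=
      IsGreatest.csSup_eq ⟨⟨_, convexOn_singleLetterLeakage_lowerInv hb hP hDD hfeas hconv,
        fun _ _ => le_rfl, rfl⟩, fun v ⟨s, _, hs, hv⟩ => hv ▸ hs t ht⟩
    rw [henv] at hlim
    refine ⟨lowerInv_eq_upperInv_of_convexOn hDD hconv ht, hlim,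
      tendsto_order.2 ⟨fun a ha => ?_, fun a ha => ?_⟩⟩
    -- From below, memoryless mechanisms are particular general ones; from above, achievability
    -- already holds at `f_l⁻¹(t)`.
    · filter_upwards [hlim.eventually_const_lt ha, eventually_ge_atTop 1] with n hn hn1
      exact hn.trans_le (csInf_le_csInf (isCompact_generalLeakages b hP d f t n).bddBelow
        (nonempty_memorylessLeakages b hP hd hfeas ht hn1)
        (memorylessLeakages_subset b P d f t n))
    · filter_upwards [eventually_memorylessLeakage_le hb hP hDD hd hfeas hf_nonneg hf_mono ht
        (half_pos (sub_pos.2 ha))] with n hn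
      linarith
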